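/- Let $(\Omega,\mathcal F,\mathsf P)$ be a complete probability space with a filtration $(\mathcal F_t)_{t=0,\dots,T}$, $\mathcal F_0$ trivial, and let $p\in[1,\infty]$. Relations between random vectors hold a.s., and random vectors are identified when a.s. equal. $L^0(X,\mathcal H)$ is the family of $\mathcal H$-measurable selections of a random set $X$, $\mathrm{cl}_0$ is closure in probability, orders are componentwise. **Conditional $L^p$.** Put $|||\xi|||_{p,\mathcal H}=\mathsf E(\|\xi\|^p|\mathcal H)^{1/p}$ for $p<\infty$, and the $\mathcal H$-conditional essential supremum of $\|\xi\|$ for $p=\infty$. $L^{p_{\mathcal H}}(\mathbb R^d,\mathcal G)$ is the family of $\mathcal G$-measurable $\xi$ with $|||\xi|||_{p,\mathcal H}<\infty$ a.s. Convergence $\xi_n\to\xi$ in it means $|||\xi_n-\xi|||_{p,\mathcal H}\to0$ in probability if $p<\infty$; for $p=\infty$ it means $\mathcal H$-bounded convergence in probability, i.e. $\xi_n\to\xi$ in probability and $\sup_n\|\xi_n\|\le c$ a.s. for some finite $\mathcal H$-measurable $c$. **Acceptance sets.** For $0\le t\le s\le T$ let $\mathcal C_{t,s}\subset L^{p_{\mathcal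 F_t}}(\mathbb R^d,\mathcal F_s)+L^0(\mathbb R^d_+,\mathcal F_s)$ satisfy: (i) $\mathcal C_{t,s}\supset L^0(\mathbb R^d_+,\mathcal F_s)$ and $\mathcal C_{t,s}\cap L^0(\mathbb R^d_-,\mathcal F_s)=\{0\}$; (ii) $\mathcal C_{t,s}=(\mathcal C_{t,s}\cap L^{p_{\mathcal F_t}}(\mathbb R^d,\mathcal F_s))+L^0(\mathbb R^d_+,\mathcal F_s)$; (iii) $\mathcal C_{t,s}\cap L^{p_{\mathcal F_t}}(\mathbb R^d,\mathcal F_T)$ is closed under the above convergence with $\mathcal H=\mathcal F_t$; (iv) $\alpha\eta'+(1-\alpha)\eta''\in\mathcal C_{t,s}$ for $\eta',\eta''\in\mathcal C_{t,s}$ and $\alpha\in L^0([0,1],\mathcal F_t)$; (v) $\mathcal C_{t,s}\cap L^0(\mathbb R^d,\mathcal F_u)=\mathcal C_{t,u}$ for $t\le u\le s$; (vi) $(\xi+\mathcal C_{t,s})\cap L^0(\mathbb R^d,\mathcal F_t)\ne\emptyset$ for $\xi\in L^{p_{\mathcal F_t}}(\mathbb R^d,\mathcal F_s)$, and $(\xi+\mathcal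 C_{t,s})\cap L^p(\mathbb R^d,\mathcal F_t)\neq\emptyset$ for $\xi\in L^p(\mathbb R^d,\mathcal F_s)$. They are *continuous from below* if, for all $t\le s$ and $\xi^n\in L^{p_{\mathcal F_t}}(\mathbb R^d,\mathcal F_s)$, $n\ge1$, with $\xi^n\uparrow\xi\in\mathcal C_{t,s}\cap L^{p_{\mathcal F_t}}(\mathbb R^d,\mathcal F_s)$ a.s. and $\xi^n\to\xi$ in $L^{p_{\mathcal F_t}}$, there are $\gamma^n\in L^0(\mathbb R^d_+,\mathcal F_t)$ with $\gamma^n+\xi^n\in\mathcal C_{t,s}$, $\gamma^n\downarrow0$ a.s., and $\gamma^1\le(\operatorname{ess\,inf}_{\mathcal F_t}\xi^1)^-$ whenever the $\mathcal F_t$-conditional essential infimum $\operatorname{ess\,inf}_{\mathcal F_t}\xi^1$ (taken componentwise) is a.s. finite, where $x^-=\max(-x,0)$. **Solvency sets.** $\mathbf K_t$, $t=0,\dots,T$, are $\mathcal F_t$-measurable random closed convex sets in $\mathbb R^d$ with $\mathbf K_t+\mathbb R^d_+\subset\mathbf K_t$ and $\mathbf K_t\cap\mathbb R^d_-=\{0\}$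 a.s. Put $\mathbf K_t^0=\bigcap_{c\ne0}c\mathbf K_t$. The solvency sets are *proper* if $\mathbf K_t^0=\{0\}$ a.s. for all $t=0,\dots,T$. **Endowments and attainable claims.** For $\Xi\subset L^0(\mathbb R^d,\mathcal F_T)$ let $\mathsf R^0_{t,s}(\Xi)$ be the set of $\gamma\in L^0(\mathbb R^d,\mathcal F_t)$ with $\gamma-\xi\in\mathcal C_{t,s}$ for some $\xi\in\Xi$, and $\mathsf R_{t,s}(\Xi)=\mathrm{cl}_0\mathsf R^0_{t,s}(\Xi)$. Let $\Xi^0_T=\hat\Xi^0_T=L^0(\mathbf K_T,\mathcal F_T)$ and, for $t<T$, $$\Xi^0_t=L^0(\mathbf K_t,\mathcal F_t)+\mathsf R^0_{t,t+1}(\Xi^0_{t+1}),\qquad \hat\Xi^0_t=L^0(\mathbf K_t,\mathcal F_t)+\mathsf R_{t,t+1}(\Xi^0_{t+1}).$$ Let $\mathsf A_{t,T}=\sum_{u=t}^TL^0(-\mathbf K_u,\mathcal F_u)-\sum_{u=t}^{T-1}\mathcal C_{u,u+1}$, and let $\overline{\mathsf A}^p_{t,T}$ be the closure of $\mathsf A_{t,T}\cap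 L^p(\mathbb R^d,\mathcal F_T)$ in $L^p$ if $p<\infty$, and its closure with respect to $\mathcal F_t$-bounded convergence in probability (the smallest superset closed under limits of so convergent sequences) if $p=\infty$. (NARA) means $(\mathrm{cl}_0\Xi^0_t)\cap L^0(\mathbb R^d_-,\mathcal F_t)=\{0\}$ for all $t=0,\dots,T$. (SNR) means $\hat\Xi^0_t\cap L^0(-\mathbf K_t,\mathcal F_t)\subset L^0(\mathbf K^0_t,\mathcal F_t)$ for all $t=0,\dots,T$. **Theorem.** Assume that the acceptance sets are continuous from below. 1. (NARA) holds if and only if $\overline{\mathsf A}^p_{t,T}\cap L^0(\mathbb R^d_+,\mathcal F_t)=\{0\}$ for all $t=0,\dots,T-1$. 2. If the solvency sets are proper, then (SNR) holds if and only if $\overline{\mathsf A}^p_{t,T}\cap L^0(\mathbf K_t,\mathcal F_t)=\{0\}$ for all $t=0,\dots,T$. -/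

import Mathlib

open MeasureTheory Filter Topology
open scoped ENNReal Pointwise

namespace RiskArbitrage

/-- The Euclidean space of dimension `d`. -/
abbrev Vec (d : ℕ) : Type := EuclideanSpace ℝ (Fin d)

/-- Random vectors modulo almost sure equality. -/
abbrev RV {Ω : Type*} {mΩ : MeasurableSpace Ω} (P : Measure Ω) (d : ℕ) : Type _ := Ω →ₘ[P] Vec d

/-- The nonnegative orthant. -/
def posOrthant (d : ℕ) : Set (Vec d) := {x | ∀ i, 0 ≤ x i}

/-- The nonpositive orthant. -/
def negOrthant (d : ℕ) : Set (Vec d) := {x | ∀ i, x i ≤ 0}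

/-- The intersection of all sets `c K`, `c ≠ 0`: the largest linear subspace contained in `K`
when `K` is a closed convex set containing the origin. -/
def linealityPart {d : ℕ} (K : Set (Vec d)) : Set (Vec d) :=
  {x | ∀ c : ℝ, c ≠ 0 → x ∈ c • K}

/-- The smallest set containing `A` that is closed under taking limits of sequences in the sense of
the convergence `conv`. -/
def convClosure {X : Type*} (conv : (ℕ → X) → X → Prop) (A : Set X) : Set X :=
  ⋂₀ {S | A ⊆ S ∧ ∀ (x : ℕ → X) (a : X), (∀ n, x n ∈ S) → conv x a → a ∈ S}

section Families

variable {Ω : Type*} {mΩ : MeasurableSpace Ω} (P : Measure Ω) {d : ℕ}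

/-- The family of `H`-measurable random vectors. -/
def L0 (H : MeasurableSpace Ω) : Set (RV P d) :=
  {ξ | AEStronglyMeasurable[H] ξ P}

/-- The family of `H`-measurable selections of the random set `X`. -/
def L0Sel (H : MeasurableSpace Ω) (X : Ω → Set (Vec d)) : Set (RV P d) :=
  {ξ | ξ ∈ L0 P H ∧ ∀ᵐ ω ∂P, ξ ω ∈ X ω}

/-- The family of `p`-integrable `H`-measurable random vectors. -/
def LpFam (p : ℝ≥0∞) (H : MeasurableSpace Ω) : Set (RV P d) :=
  {ξ | ξ ∈ L0 P H ∧ MemLp ξ p P}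

/-- The conditional `p`-norm `E(‖ξ‖ ^ p | H) ^ (1 / p)` for finite `p`; the conditional expectation
of a nonnegative variable is taken with values in `[0, ∞]`. -/
noncomputable def condNorm (p : ℝ≥0∞) (H : MeasurableSpace Ω) (ξ : RV P d) : Ω → ℝ≥0∞ :=
  fun ω => (condLExp H P (fun ω' => ‖ξ ω'‖ₑ ^ p.toReal) ω) ^ (1 / p.toReal)

/-- The `G`-measurable random vectors with an almost surely finite conditional `p`-norm given `H`.
For `p = ∞` the `H`-conditional essential supremum of `‖ξ‖` is the smallest `H`-measurable
upper bound with values in `[0, ∞]`, so it is almost surely finite if and only if there is a finite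
`H`-measurable upper bound. -/
def CondLp (p : ℝ≥0∞) (H G : MeasurableSpace Ω) : Set (RV P d) :=
  {ξ | ξ ∈ L0 P G ∧
    if p = ∞ then ∃ c : Ω → ℝ, Measurable[H] c ∧ ∀ᵐ ω ∂P, ‖ξ ω‖ ≤ c ω
    else ∀ᵐ ω ∂P, condNorm P p H ξ ω < ∞}

/-- Sums of an element of `CondLp P p H G` and a nonnegative `G`-measurable random vector. -/
def CondLpBar (p : ℝ≥0∞) (H G : MeasurableSpace Ω) : Set (RV P d) :=
  CondLp P p H G + L0Sel P G (fun _ => posOrthant d)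

/-- Convergence in probability. -/
def Tendsto0 (x : ℕ → RV P d) (a : RV P d) : Prop :=
  TendstoInMeasure P (fun n => (x n : Ω → Vec d)) atTop a

/-- `H`-bounded convergence in probability: convergence in probability of a sequence whose norms
are bounded by a single finite `H`-measurable random variable. -/
def TendstoBdd (H : MeasurableSpace Ω) (x : ℕ → RV P d) (a : RV P d) : Prop :=
  (∃ c : Ω → ℝ, Measurable[H] c ∧ ∀ n, ∀ᵐ ω ∂P, ‖x n ω‖ ≤ c ω) ∧ Tendsto0 P x a

/-- Convergence in the module `CondLp P p H G`: for finite `p` the conditional `p`-norm of the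
difference tends to zero in probability, for `p = ∞` this is `H`-bounded convergence in
probability. -/
def TendstoCondLp (p : ℝ≥0∞) (H : MeasurableSpace Ω) (x : ℕ → RV P d) (a : RV P d) : Prop :=
  if p = ∞ then TendstoBdd P H x a
  else ∀ ε : ℝ≥0∞, 0 < ε →
    Tendsto (fun n => P {ω | ε ≤ condNorm P p H (x n - a) ω}) atTop (𝓝 0)

/-- The convergence used to close families of `p`-integrable vectors: norm convergence for
finite `p`, and `H`-bounded convergence in probability for `p = ∞`. -/
def TendstoLp (p : ℝ≥0∞) (H : MeasurableSpace Ω) (x : ℕ → RV P d) (a : RV P d) : Prop :=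
  if p = ∞ then TendstoBdd P H x a
  else Tendsto (fun n => eLpNorm (x n - a : RV P d) p P) atTop (𝓝 0)

/-- Closure in probability. -/
def cl0 (A : Set (RV P d)) : Set (RV P d) := convClosure (Tendsto0 P) A

/-- Closure with respect to `TendstoLp`. -/
def clp (p : ℝ≥0∞) (H : MeasurableSpace Ω) (A : Set (RV P d)) : Set (RV P d) :=
  convClosure (TendstoLp P p H) A

/-- `m` is the componentwise `H`-conditional essential infimum of `ξ` and all its components are
almost surely finite: it is the largest `H`-measurable random vector below `ξ`. -/
def IsCondEssInf (H : MeasurableSpace Ω) (ξ m : RV P d) : Prop :=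
  (m ∈ L0 P H ∧ ∀ᵐ ω ∂P, ∀ i, m ω i ≤ ξ ω i) ∧
    ∀ m' : RV P d, m' ∈ L0 P H → (∀ᵐ ω ∂P, ∀ i, m' ω i ≤ ξ ω i) →
      ∀ᵐ ω ∂P, ∀ i, m' ω i ≤ m ω i

end Families

section Model

variable {Ω : Type*} {mΩ : MeasurableSpace Ω} (P : Measure Ω) (ℱ : Filtration ℕ mΩ) (T : ℕ)
  {d : ℕ}

/-- Discrete time `L^p`-dynamic convex acceptance sets `C t s`, `0 ≤ t ≤ s ≤ T`. -/
structure IsAcceptanceFamily (p : ℝ≥0∞) (C : ℕ → ℕ → Set (RV P d)) : Prop where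
  subset_bar : ∀ t s, t ≤ s → s ≤ T → C t s ⊆ CondLpBar P p (ℱ t) (ℱ s)
  nonneg_subset : ∀ t s, t ≤ s → s ≤ T → L0Sel P (ℱ s) (fun _ => posOrthant d) ⊆ C t s
  inter_nonpos : ∀ t s, t ≤ s → s ≤ T → C t s ∩ L0Sel P (ℱ s) (fun _ => negOrthant d) = {0}
  integrability : ∀ t s, t ≤ s → s ≤ T →
    C t s = (C t s ∩ CondLp P p (ℱ t) (ℱ s)) + L0Sel P (ℱ s) (fun _ => posOrthant d)
  closedness : ∀ t s, t ≤ s → s ≤ T → ∀ (x : ℕ → RV P d) (a : RV P d),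
    (∀ n, x n ∈ C t s ∩ CondLp P p (ℱ t) (ℱ T)) → a ∈ CondLp P p (ℱ t) (ℱ T) →
    TendstoCondLp P p (ℱ t) x a → a ∈ C t s
  cond_convex : ∀ t s, t ≤ s → s ≤ T → ∀ α : Ω → ℝ, Measurable[ℱ t] α →
    (∀ ω, 0 ≤ α ω ∧ α ω ≤ 1) → ∀ η ∈ C t s, ∀ η' ∈ C t s, ∀ ζ : RV P d,
    (∀ᵐ ω ∂P, ζ ω = α ω • η ω + (1 - α ω) • η' ω) → ζ ∈ C t s
  time_consistent : ∀ t u s, t ≤ u → u ≤ s → s ≤ T → C t s ∩ L0 P (ℱ u) = C t u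
  compensation : ∀ t s, t ≤ s → s ≤ T → ∀ ξ ∈ CondLp P p (ℱ t) (ℱ s),
    (({ξ} + C t s) ∩ L0 P (ℱ t)).Nonempty
  compensation_Lp : ∀ t s, t ≤ s → s ≤ T → ∀ ξ ∈ LpFam P p (ℱ s),
    (({ξ} + C t s) ∩ LpFam P p (ℱ t)).Nonempty

/-- Continuity from below of acceptance sets. The last clause says that the first compensator is at
most the negative part of the conditional essential infimum when the latter is finite. -/
def ContinuousFromBelow (p : ℝ≥0∞) (C : ℕ → ℕ → Set (RV P d)) : Prop :=
  ∀ t s, t ≤ s → s ≤ T → ∀ (x : ℕ → RV P d) (ξ : RV P d),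
    (∀ n, x n ∈ CondLp P p (ℱ t) (ℱ s)) →
    ξ ∈ C t s ∩ CondLp P p (ℱ t) (ℱ s) →
    (∀ᵐ ω ∂P, ∀ i, Monotone (fun n => x n ω i) ∧
      Tendsto (fun n => x n ω i) atTop (𝓝 (ξ ω i))) →
    TendstoCondLp P p (ℱ t) x ξ →
    ∃ γ : ℕ → RV P d,
      (∀ n, γ n ∈ L0Sel P (ℱ t) (fun _ => posOrthant d)) ∧
      (∀ n, γ n + x n ∈ C t s) ∧
      (∀ᵐ ω ∂P, ∀ i, Antitone (fun n => γ n ω i) ∧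
        Tendsto (fun n => γ n ω i) atTop (𝓝 0)) ∧
      ∀ m : RV P d, IsCondEssInf P (ℱ t) (x 0) m →
        ∀ᵐ ω ∂P, ∀ i, γ 0 ω i ≤ max (-(m ω i)) 0

/-- Solvency sets: adapted random closed convex upper sets that meet the nonpositive orthant only at
the origin. -/
structure IsSolvencyFamily (K : ℕ → Ω → Set (Vec d)) : Prop where
  measurable_graph : ∀ t, t ≤ T →
    @MeasurableSet (Ω × Vec d) ((ℱ t).prod inferInstance) {q | q.2 ∈ K t q.1}
  closed : ∀ t, t ≤ T → ∀ᵐ ω ∂P, IsClosed (K t ω)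
  convex : ∀ t, t ≤ T → ∀ᵐ ω ∂P, Convex ℝ (K t ω)
  upper : ∀ t, t ≤ T → ∀ᵐ ω ∂P, K t ω + posOrthant d ⊆ K t ω
  inter_nonpos : ∀ t, t ≤ T → ∀ᵐ ω ∂P, K t ω ∩ negOrthant d = {0}

/-- The solvency sets are proper: they contain no nontrivial linear subspace. -/
def IsProper (K : ℕ → Ω → Set (Vec d)) : Prop :=
  ∀ t, t ≤ T → ∀ᵐ ω ∂P, linealityPart (K t ω) = {0}

/-- The set of `ℱ t`-measurable `γ` such that `γ - ξ` belongs to `C t s` for some `ξ` in `Ξ`. -/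
def selRisk0 (C : ℕ → ℕ → Set (RV P d)) (t s : ℕ) (Ξ : Set (RV P d)) : Set (RV P d) :=
  {γ | γ ∈ L0 P (ℱ t) ∧ ∃ ξ ∈ Ξ, γ - ξ ∈ C t s}

/-- The dynamic selection risk measure. -/
def selRisk (C : ℕ → ℕ → Set (RV P d)) (t s : ℕ) (Ξ : Set (RV P d)) : Set (RV P d) :=
  cl0 P (selRisk0 P ℱ C t s Ξ)

/-- The family of endowments at time `t` that superhedge the zero claim, by backward recursion from
the selections of the terminal solvency set. -/
def endow (C : ℕ → ℕ → Set (RV P d)) (K : ℕ → Ω → Set (Vec d)) (t : ℕ) : Set (RV P d) :=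
  if t < T then
    L0Sel P (ℱ t) (K t) + selRisk0 P ℱ C t (t + 1) (endow C K (t + 1))
  else L0Sel P (ℱ T) (K T)
termination_by T - t

/-- The variant of `endow` with the closed selection risk measure in the first step. -/
def endowHat (C : ℕ → ℕ → Set (RV P d)) (K : ℕ → Ω → Set (Vec d)) (t : ℕ) : Set (RV P d) :=
  if t < T then
    L0Sel P (ℱ t) (K t) + selRisk P ℱ C t (t + 1) (endow P ℱ T C K (t + 1))
  else L0Sel P (ℱ T) (K T)

/-- Positions attainable at time `s` from zero investment at time `t`. -/
def attainable (C : ℕ → ℕ → Set (RV P d)) (K : ℕ → Ω → Set (Vec d)) (t s : ℕ) :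
    Set (RV P d) :=
  ∑ u ∈ Finset.Icc t s, L0Sel P (ℱ u) (fun ω => -(K u ω)) - ∑ u ∈ Finset.Ico t s, C u (u + 1)

/-- The closure of the `p`-integrable attainable positions at the terminal time. -/
def attainableClosure (p : ℝ≥0∞) (C : ℕ → ℕ → Set (RV P d)) (K : ℕ → Ω → Set (Vec d))
    (t : ℕ) : Set (RV P d) :=
  clp P p (ℱ t) (attainable P ℱ C K t T ∩ LpFam P p (ℱ T))

/-- No asymptotic risk arbitrage. -/
def NARA (C : ℕ → ℕ → Set (RV P d)) (K : ℕ → Ω → Set (Vec d)) : Prop :=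
  ∀ t, t ≤ T →
    cl0 P (endow P ℱ T C K t) ∩ L0Sel P (ℱ t) (fun _ => negOrthant d) = {0}

/-- Strict no risk arbitrage. -/
def SNR (C : ℕ → ℕ → Set (RV P d)) (K : ℕ → Ω → Set (Vec d)) : Prop :=
  ∀ t, t ≤ T →
    endowHat P ℱ T C K t ∩ L0Sel P (ℱ t) (fun ω => -(K t ω)) ⊆
      L0Sel P (ℱ t) (fun ω => linealityPart (K t ω))

end Model

end RiskArbitrage

open RiskArbitrage

/-! Unwinding the backward recursion shows that the endowments at time `t` are exactly the negatives
of those attainable positions that are already `ℱ t`-measurable (`mem_endow_iff`). With `A` the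
attainable set and `H = ℱ t`, both parts then compare the closure of `A ∩ L^p` with the closure in
probability of `A ∩ L⁰(H)`, each intersected with the `H`-measurable selections of a random set
containing the origin (`clp_inter_L0Sel_eq_iff`).

One direction is localization: a sequence of `H`-measurable vectors that converges almost surely is
bounded on each of countably many `H`-measurable events exhausting the space, and restricting to
such an event turns the limit into an element of the `L^p`-type closure.

The other direction rests on continuity from below. If `a n → a` in the `L^p` sense, then, along a
subsequence and outside a small `H`-measurable event, the tail suprema `z n` of `e⁻¹ ‖a n - a‖`,
repeated in every coordinate, decrease to zero and are dominated in `L^p`. Such `z n` can be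
compensated by `H`-measurable `γ n` decreasing to zero with `z n - γ n ∈ A`
(`exists_attainable_compensator`). The mixture `(1 - e) a n + e (z n - γ n)` lies in `A` by
convexity and dominates `(1 - e) a - e γ n`, which is therefore in `A` too. As `A` need not be a
cone, the factor `1 - e` cannot be avoided. The property "in `A` up to a scaling near one and a
small `H`-measurable shift" survives further limits (`compensable_closed`), so it holds on the whole
sequential closure; for an `H`-measurable vector it implies membership in the closure in probability
of `A ∩ L⁰(H)`.

For proper solvency sets, (SNR) says that the partially closed sets `endowHat` meet the selections
of `-K` only in zero. The full closure in probability then does so as well, by a recession argument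
with measurably chosen random subsequences (`cl0_add_inter_subset`). -/

namespace RiskArbitrage

/-! ### Sequential closures. -/

section Closure

variable {X : Type*} {conv : (ℕ → X) → X → Prop} {A B : Set X}

theorem subset_convClosure : A ⊆ convClosure conv A := fun _ hx _ hS => hS.1 hx

theorem convClosure_subset (hAB : A ⊆ B)
    (hB : ∀ (x : ℕ → X) (a : X), (∀ n, x n ∈ B) → conv x a → a ∈ B) :
    convClosure conv A ⊆ B := fun _ hx => hx B ⟨hAB, hB⟩

theorem mem_convClosure_of_conv {x : ℕ → X} {a : X} (hx : ∀ n, x n ∈ convClosure conv A)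
    (h : conv x a) : a ∈ convClosure conv A :=
  fun S hS => hS.2 x a (fun n => hx n S hS) h

end Closure

/-! ### Measurable representatives and conditional convexity. -/

section Basic

variable {Ω : Type*} {H G mΩ : MeasurableSpace Ω} {P : Measure Ω} {d : ℕ}

theorem exists_measurable_rep {ξ : RV P d} (h : ξ ∈ L0 P H) :
    ∃ g : Ω → Vec d, Measurable[H] g ∧ ξ =ᵐ[P] g := by
  obtain ⟨g, hg, hξ⟩ := h
  exact ⟨g, hg.measurable, hξ⟩

theorem mem_L0_of_ae_eq {ξ : RV P d} {g : Ω → Vec d} (hg : Measurable[H] g) (h : ξ =ᵐ[P] g) :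
    ξ ∈ L0 P H :=
  ⟨g, Measurable.stronglyMeasurable hg, h⟩

theorem exists_mem_L0 (P : Measure Ω) (hH : H ≤ mΩ) {g : Ω → Vec d} (hg : Measurable[H] g) :
    ∃ ζ : RV P d, ζ ∈ L0 P H ∧ ζ =ᵐ[P] g := by
  have hg' : AEStronglyMeasurable g P := (hg.mono hH le_rfl).aestronglyMeasurable
  exact ⟨AEEqFun.mk g hg', mem_L0_of_ae_eq hg (AEEqFun.coeFn_mk g hg'), AEEqFun.coeFn_mk g hg'⟩

theorem L0_mono (h : H ≤ G) : (L0 P H : Set (RV P d)) ⊆ L0 P G :=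
  fun _ hξ => AEStronglyMeasurable.mono h hξ

theorem zero_mem_L0 : (0 : RV P d) ∈ L0 P H :=
  mem_L0_of_ae_eq (@measurable_const (Vec d) Ω _ H 0) AEEqFun.coeFn_zero

theorem add_mem_L0 {ξ η : RV P d} (h : ξ ∈ L0 P H) (h' : η ∈ L0 P H) : ξ + η ∈ L0 P H :=
  (AEStronglyMeasurable.add h h').congr (AEEqFun.coeFn_add ξ η).symm

theorem neg_mem_L0 {ξ : RV P d} (h : ξ ∈ L0 P H) : -ξ ∈ L0 P H :=
  (AEStronglyMeasurable.neg h).congr (AEEqFun.coeFn_neg ξ).symm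

theorem sub_mem_L0 {ξ η : RV P d} (h : ξ ∈ L0 P H) (h' : η ∈ L0 P H) : ξ - η ∈ L0 P H := by
  rw [sub_eq_add_neg]; exact add_mem_L0 h (neg_mem_L0 h')

theorem neg_mem_L0_iff {ξ : RV P d} : -ξ ∈ L0 P H ↔ ξ ∈ L0 P H :=
  ⟨fun h => by simpa using neg_mem_L0 h, neg_mem_L0⟩

theorem mem_L0_of_ae_tendsto {x : ℕ → RV P d} {a : RV P d} (hx : ∀ n, x n ∈ L0 P H)
    (h : ∀ᵐ ω ∂P, Tendsto (fun n => x n ω) atTop (𝓝 (a ω))) : a ∈ L0 P H := by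
  choose g hg hxg using fun n => (hx n : AEStronglyMeasurable[H] (x n) P)
  refine ⟨fun ω => limUnder atTop fun n => g n ω, ?_, ?_⟩
  · exact @StronglyMeasurable.limUnder ℕ Ω (Vec d) H _ _ _ _ _ _ _ hg
  · filter_upwards [h, ae_all_iff.2 hxg] with ω h1 h2
    simp only [h2] at h1
    exact h1.limUnder_eq.symm

/-- Convex combinations with measurable random weights. -/
def CondConvex (P : Measure Ω) (H : MeasurableSpace Ω) (S : Set (RV P d)) : Prop :=
  ∀ α : Ω → ℝ, Measurable[H] α → (∀ ω, 0 ≤ α ω ∧ α ω ≤ 1) → ∀ η ∈ S, ∀ η' ∈ S, ∀ ζ : RV P d,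
    (∀ᵐ ω ∂P, ζ ω = α ω • η ω + (1 - α ω) • η' ω) → ζ ∈ S

theorem CondConvex.mono {S : Set (RV P d)} (hS : CondConvex P G S) (h : H ≤ G) :
    CondConvex P H S :=
  fun α hα => hS α (hα.mono h le_rfl)

theorem CondConvex.smul_mem {S : Set (RV P d)} (hS : CondConvex P H S) (h0 : (0 : RV P d) ∈ S)
    {α : Ω → ℝ} (hα : Measurable[H] α) (h01 : ∀ ω, 0 ≤ α ω ∧ α ω ≤ 1) {η ζ : RV P d}
    (hη : η ∈ S) (hζ : ∀ᵐ ω ∂P, ζ ω = α ω • η ω) : ζ ∈ S := by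
  refine hS α hα h01 η hη 0 h0 ζ ?_
  filter_upwards [hζ, AEEqFun.coeFn_zero (μ := P) (β := Vec d)] with ω h1 h2
  simp [h1, h2]

theorem condConvex_L0 (P : Measure Ω) (hH : H ≤ G) : CondConvex P H (L0 P G : Set (RV P d)) := by
  intro α hα _ η hη η' hη' ζ hζ
  obtain ⟨g, hg, h1⟩ := exists_measurable_rep hη
  obtain ⟨g', hg', h2⟩ := exists_measurable_rep hη'
  have hα' := hα.mono hH le_rfl
  refine mem_L0_of_ae_eq (g := fun ω => α ω • g ω + (1 - α ω) • g' ω) ?_ ?_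
  · exact (hα'.smul hg).add ((measurable_const.sub hα').smul hg')
  · filter_upwards [hζ, h1, h2] with ω h h1 h2
    rw [h, h1, h2]

theorem condConvex_L0Sel (P : Measure Ω) (hH : H ≤ G) {K : Ω → Set (Vec d)}
    (hK : ∀ᵐ ω ∂P, Convex ℝ (K ω)) : CondConvex P H (L0Sel P G K) := by
  intro α hα h01 η hη η' hη' ζ hζ
  refine ⟨condConvex_L0 P hH α hα h01 η hη.1 η' hη'.1 ζ hζ, ?_⟩
  filter_upwards [hK, hη.2, hη'.2, hζ] with ω h h1 h2 h3
  rw [h3]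
  exact h h1 h2 (h01 ω).1 (by linarith [(h01 ω).2]) (by ring)

theorem CondConvex.exists_mem {S : Set (RV P d)} (hS : CondConvex P H S) (hH : H ≤ mΩ)
    {α : Ω → ℝ} (hα : Measurable[H] α) (h01 : ∀ ω, 0 ≤ α ω ∧ α ω ≤ 1) {η η' : RV P d}
    (hη : η ∈ S) (hη' : η' ∈ S) :
    ∃ ζ ∈ S, ∀ᵐ ω ∂P, ζ ω = α ω • η ω + (1 - α ω) • η' ω := by
  have hm : Measurable fun ω => α ω := hα.mono hH le_rfl
  have hf : AEStronglyMeasurable (fun ω => α ω • η ω + (1 - α ω) • η' ω) P :=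
    (hm.aestronglyMeasurable.smul η.aestronglyMeasurable).add
      ((hm.const_sub 1).aestronglyMeasurable.smul η'.aestronglyMeasurable)
  exact ⟨AEEqFun.mk _ hf, hS α hα h01 _ hη _ hη' _ (AEEqFun.coeFn_mk _ hf), AEEqFun.coeFn_mk _ hf⟩

theorem CondConvex.add {S S' : Set (RV P d)} (hH : H ≤ mΩ) (hS : CondConvex P H S)
    (hS' : CondConvex P H S') : CondConvex P H (S + S') := by
  rintro α hα h01 _ ⟨a, ha, b, hb, rfl⟩ _ ⟨a', ha', b', hb', rfl⟩ ζ hζ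
  obtain ⟨w, hw, hweq⟩ := hS.exists_mem hH hα h01 ha ha'
  refine ⟨w, hw, ζ - w, hS' α hα h01 b hb b' hb' _ ?_, by simp⟩
  filter_upwards [hweq, hζ, AEEqFun.coeFn_sub ζ w, AEEqFun.coeFn_add a b,
    AEEqFun.coeFn_add a' b'] with ω e1 e2 e3 e4 e5
  rw [e3, Pi.sub_apply, e1, e2, e4, e5, Pi.add_apply, Pi.add_apply]
  module

theorem CondConvex.neg {S : Set (RV P d)} (hS : CondConvex P H S) : CondConvex P H (-S) := by
  intro α hα h01 η hη η' hη' ζ hζ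
  refine hS α hα h01 _ hη _ hη' _ ?_
  filter_upwards [hζ, AEEqFun.coeFn_neg ζ, AEEqFun.coeFn_neg η, AEEqFun.coeFn_neg η']
    with ω e1 e2 e3 e4
  rw [e2, e3, e4, Pi.neg_apply, Pi.neg_apply, Pi.neg_apply, e1]
  module

theorem CondConvex.inter {S S' : Set (RV P d)} (hS : CondConvex P H S)
    (hS' : CondConvex P H S') : CondConvex P H (S ∩ S') :=
  fun α hα h01 η hη η' hη' ζ hζ =>
    ⟨hS α hα h01 η hη.1 η' hη'.1 ζ hζ, hS' α hα h01 η hη.2 η' hη'.2 ζ hζ⟩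

end Basic

/-! ### Closure in probability and almost sure limits. -/

section Convergence

variable {Ω : Type*} {H mΩ : MeasurableSpace Ω} {P : Measure Ω} {d : ℕ}

theorem Tendsto0.eventually_exists {x : ℕ → RV P d} {a : RV P d} (h : Tendsto0 P x a) {ε : ℝ}
    (hε : 0 < ε) :
    ∀ᶠ n in atTop, ∃ N : Set Ω, P N ≤ ENNReal.ofReal ε ∧ ∀ ω ∉ N, ‖x n ω - a ω‖ ≤ ε := by
  have h1 := tendstoInMeasure_iff_norm.1 h ε hε
  filter_upwards [h1.eventually_le_const (ENNReal.ofReal_pos.2 hε)] with n hn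
  exact ⟨_, hn, fun ω hω => (not_le.1 hω).le⟩

theorem tendsto0_of_ae [IsFiniteMeasure P] {x : ℕ → RV P d} {a : RV P d}
    (h : ∀ᵐ ω ∂P, Tendsto (fun n => x n ω) atTop (𝓝 (a ω))) : Tendsto0 P x a :=
  tendstoInMeasure_of_tendsto_ae (fun n => (x n).aestronglyMeasurable) h

theorem ae_eventually_notMem_of_le_half_pow {N : ℕ → Set Ω}
    (hN : ∀ n, P (N n) ≤ ENNReal.ofReal ((1 / 2) ^ n)) : ∀ᵐ ω ∂P, ∀ᶠ n in atTop, ω ∉ N n := by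
  refine ae_eventually_notMem (ne_top_of_le_ne_top ?_ (ENNReal.tsum_le_tsum hN))
  rw [← ENNReal.ofReal_tsum_of_nonneg (fun n => by positivity) summable_geometric_two]
  exact ENNReal.ofReal_ne_top

/-- One limit suffices although the closure is an iterated one: the vectors approximable from `A`
outside events of small probability already form a set stable under convergence in probability.
Tolerances `(1 / 2) ^ n` and the Borel–Cantelli lemma then give almost sure convergence. -/
theorem exists_ae_tendsto_of_mem_cl0 {A : Set (RV P d)} {ξ : RV P d} (hξ : ξ ∈ cl0 P A) :
    ∃ y : ℕ → RV P d, (∀ n, y n ∈ A) ∧ ∀ᵐ ω ∂P, Tendsto (fun n => y n ω) atTop (𝓝 (ξ ω)) := by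
  have key : cl0 P A ⊆ {ξ | ∀ ε : ℝ, 0 < ε → ∃ a ∈ A, ∃ N : Set Ω, P N ≤ ENNReal.ofReal ε ∧
      ∀ ω ∉ N, ‖a ω - ξ ω‖ ≤ ε} := by
    refine convClosure_subset (fun a ha ε hε => ⟨a, ha, ∅, by simp, fun ω _ => by simp [hε.le]⟩) ?_
    intro x a hx hxa ε hε
    obtain ⟨n, N, hN, hNn⟩ := (Tendsto0.eventually_exists hxa (half_pos hε)).exists
    obtain ⟨b, hb, N', hN', hbN⟩ := hx n (ε / 2) (half_pos hε)
    refine ⟨b, hb, N ∪ N', (measure_union_le _ _).trans ((add_le_add hN hN').trans ?_), ?_⟩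
    · rw [← ENNReal.ofReal_add (by positivity) (by positivity), add_halves]
    · intro ω hω
      simp only [Set.mem_union, not_or] at hω
      have h1 := hNn ω hω.1
      have h2 := hbN ω hω.2
      calc ‖b ω - a ω‖ = ‖(b ω - x n ω) + (x n ω - a ω)‖ := by congr 1; abel
        _ ≤ _ := norm_add_le _ _
        _ ≤ ε := by linarith
  choose y hy N hN hyN using fun n : ℕ => key hξ ((1 / 2) ^ n) (by positivity)
  refine ⟨y, hy, ?_⟩
  filter_upwards [ae_eventually_notMem_of_le_half_pow hN] with ω hω
  rw [tendsto_iff_norm_sub_tendsto_zero]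
  refine squeeze_zero' (Eventually.of_forall fun _ => norm_nonneg _) ?_
    (tendsto_pow_atTop_nhds_zero_of_lt_one (r := (1 / 2 : ℝ)) (by norm_num) (by norm_num))
  filter_upwards [hω] with n hn using hyN n ω hn

theorem mem_cl0_of_ae_tendsto [IsFiniteMeasure P] {A : Set (RV P d)} {y : ℕ → RV P d} {ξ : RV P d}
    (hy : ∀ n, y n ∈ cl0 P A) (h : ∀ᵐ ω ∂P, Tendsto (fun n => y n ω) atTop (𝓝 (ξ ω))) :
    ξ ∈ cl0 P A :=
  mem_convClosure_of_conv hy (tendsto0_of_ae h)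

theorem CondConvex.cl0 [IsFiniteMeasure P] {S : Set (RV P d)} (hH : H ≤ mΩ)
    (hS : CondConvex P H S) : CondConvex P H (cl0 P S) := by
  intro α hα h01 η hη η' hη' ζ hζ
  obtain ⟨y, hy, h⟩ := exists_ae_tendsto_of_mem_cl0 hη
  obtain ⟨y', hy', h'⟩ := exists_ae_tendsto_of_mem_cl0 hη'
  choose w hw hweq using fun n => hS.exists_mem hH hα h01 (hy n) (hy' n)
  refine mem_cl0_of_ae_tendsto (fun n => subset_convClosure (hw n)) ?_
  filter_upwards [h, h', hζ, ae_all_iff.2 hweq] with ω e e' e1 e2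
  rw [e1]
  simp only [e2]
  exact (e.const_smul _).add (e'.const_smul _)

end Convergence

/-! ### Dominated convergence for the conditional and unconditional `L^p` modes. -/

section Integrability

variable {Ω : Type*} {H G mΩ : MeasurableSpace Ω} {P : Measure Ω} {d : ℕ} {p : ℝ≥0∞}

theorem LpFam_subset_CondLp (hp : 1 ≤ p) : (LpFam P p G : Set (RV P d)) ⊆ CondLp P p H G := by
  rintro ξ ⟨hξ, hLp⟩
  refine ⟨hξ, ?_⟩
  have hp0 : p ≠ 0 := (zero_lt_one.trans_le hp).ne'
  split_ifs with htop
  · subst htop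
    have h := hLp.2
    rw [eLpNorm_exponent_top] at h
    refine ⟨fun _ => (eLpNormEssSup ξ P).toReal, measurable_const, ?_⟩
    filter_upwards [ae_le_eLpNormEssSup (f := ξ) (μ := P)] with ω hω
    rw [← toReal_enorm]
    exact ENNReal.toReal_mono h.ne hω
  · have h := lintegral_rpow_enorm_lt_top_of_eLpNorm_lt_top hp0 htop hLp.2
    filter_upwards [condLExp_lt_top (mΩ := H) h.ne] with ω hω
    exact ENNReal.rpow_lt_top_of_nonneg (by positivity) hω.ne

theorem tendsto_lintegral_rpow_enorm_of_dominated (hp : 1 ≤ p) (htop : p ≠ ∞)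
    {y : ℕ → Ω → Vec d} (hym : ∀ n, AEStronglyMeasurable (y n) P)
    (h0 : ∀ᵐ ω ∂P, Tendsto (fun n => y n ω) atTop (𝓝 0))
    {g : Ω → ℝ} (hg : MemLp g p P) (hy : ∀ n, ∀ᵐ ω ∂P, ‖y n ω‖ ≤ g ω) :
    Tendsto (fun n => ∫⁻ ω, ‖y n ω‖ₑ ^ p.toReal ∂P) atTop (𝓝 0) := by
  have hp0 : p ≠ 0 := (zero_lt_one.trans_le hp).ne'
  have hpr : 0 < p.toReal := ENNReal.toReal_pos hp0 htop
  have key := tendsto_lintegral_of_dominated_convergence' (μ := P)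
    (F := fun n ω => ‖y n ω‖ₑ ^ p.toReal) (f := fun _ => 0) (fun ω => ‖g ω‖ₑ ^ p.toReal)
    (fun n => (hym n).enorm.pow_const _) (fun n => ?_)
    (lintegral_rpow_enorm_lt_top_of_eLpNorm_lt_top hp0 htop hg.2).ne ?_
  · simpa using key
  · filter_upwards [hy n] with ω hω
    refine ENNReal.rpow_le_rpow ?_ hpr.le
    rw [enorm_le_iff_norm_le]
    exact hω.trans (le_abs_self _)
  · filter_upwards [h0] with ω hω
    have := ((ENNReal.continuous_rpow_const (y := p.toReal)).tendsto _).comp hω.enorm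
    simpa [Function.comp_def, ENNReal.zero_rpow_of_pos hpr] using this

/-- For finite `p`, Markov's inequality applied to the conditional `p`-th moment reduces the claim
to convergence of the unconditional one, which is dominated convergence. -/
theorem tendstoCondLp_zero_of_dominated [IsProbabilityMeasure P] (hH : H ≤ mΩ) (hp : 1 ≤ p)
    {x : ℕ → RV P d} (h0 : ∀ᵐ ω ∂P, Tendsto (fun n => x n ω) atTop (𝓝 0))
    {g : Ω → ℝ} (hg : MemLp g p P) (hx : ∀ n, ∀ᵐ ω ∂P, ‖x n ω‖ ≤ g ω) :
    TendstoCondLp P p H x 0 := by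
  have hp0 : p ≠ 0 := (zero_lt_one.trans_le hp).ne'
  unfold TendstoCondLp
  split_ifs with htop
  · subst htop
    refine ⟨⟨fun _ => (eLpNormEssSup g P).toReal, measurable_const, fun n => ?_⟩, ?_⟩
    · have h := hg.2
      rw [eLpNorm_exponent_top] at h
      filter_upwards [ae_le_eLpNormEssSup (f := g) (μ := P), hx n] with ω hω h'
      refine (h'.trans (le_abs_self _)).trans ?_
      rw [← Real.norm_eq_abs, ← toReal_enorm]
      exact ENNReal.toReal_mono h.ne hω
    · refine tendsto0_of_ae ?_
      filter_upwards [h0, AEEqFun.coeFn_zero (μ := P) (β := Vec d)] with ω h1 h2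
      rw [h2]; exact h1
  · intro ε hε
    have hpr : 0 < p.toReal := ENNReal.toReal_pos hp0 htop
    -- Markov's inequality needs a finite level. At level `∞` the event is null because the
    -- conditional norms are almost surely finite.
    by_cases hε' : ε = ∞
    · subst hε'
      have : ∀ n, P {ω | ∞ ≤ condNorm P p H (x n - 0) ω} = 0 := by
        intro n
        have hL : x n ∈ CondLp P p H mΩ :=
          LpFam_subset_CondLp hp ⟨(x n).aestronglyMeasurable,
            hg.mono' (x n).aestronglyMeasurable (hx n)⟩
        have := hL.2
        rw [if_neg htop] at this
        rw [sub_zero]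
        refine measure_mono_null ?_ (ae_iff.1 this)
        intro ω hω
        simpa using hω
      simp_rw [this]
      exact tendsto_const_nhds
    have key := tendsto_lintegral_rpow_enorm_of_dominated hp htop
      (fun n => (x n).aestronglyMeasurable) h0 hg hx
    have hεp : ε ^ p.toReal ≠ 0 := (ENNReal.rpow_pos hε hε').ne'
    have hεp' : ε ^ p.toReal ≠ ∞ := ENNReal.rpow_ne_top_of_nonneg hpr.le hε'
    have hb : ∀ n, P {ω | ε ≤ condNorm P p H (x n - 0) ω} ≤
        (∫⁻ ω, ‖x n ω‖ₑ ^ p.toReal ∂P) / ε ^ p.toReal := by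
      intro n
      rw [sub_zero, ← lintegral_condLExp hH P]
      refine (measure_mono fun ω hω => ?_).trans (meas_ge_le_lintegral_div
        (measurable_condLExp' H P _).aemeasurable hεp hεp')
      have h1 : ε ≤ condNorm P p H (x n) ω := hω
      have h2 := ENNReal.rpow_le_rpow h1 hpr.le
      rwa [condNorm, ← ENNReal.rpow_mul, one_div, inv_mul_cancel₀ hpr.ne', ENNReal.rpow_one] at h2
    refine tendsto_of_tendsto_of_tendsto_of_le_of_le tendsto_const_nhds ?_ (fun _ => bot_le) hb
    simpa using ENNReal.Tendsto.div_const key (Or.inr hεp)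

theorem tendstoLp_of_bounded [IsProbabilityMeasure P] (hp : 1 ≤ p) {x : ℕ → RV P d} {a : RV P d}
    (h : ∀ᵐ ω ∂P, Tendsto (fun n => x n ω) atTop (𝓝 (a ω))) {c : ℝ}
    (hx : ∀ n, ∀ᵐ ω ∂P, ‖x n ω‖ ≤ c) : TendstoLp P p H x a := by
  have hp0 : p ≠ 0 := (zero_lt_one.trans_le hp).ne'
  unfold TendstoLp
  split_ifs with htop
  · exact ⟨⟨fun _ => c, measurable_const, hx⟩, tendsto0_of_ae h⟩
  · have hpr : 0 < p.toReal := ENNReal.toReal_pos hp0 htop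
    have key := tendsto_lintegral_rpow_enorm_of_dominated (P := P) hp htop
      (y := fun n => ⇑(x n - a)) (fun n => (x n - a).aestronglyMeasurable) ?_
      (memLp_const (c + c)) ?_
    · simp_rw [eLpNorm_eq_lintegral_rpow_enorm_toReal hp0 htop]
      have := ((ENNReal.continuous_rpow_const (y := 1 / p.toReal)).tendsto _).comp key
      simpa [Function.comp_def, ENNReal.zero_rpow_of_pos (inv_pos.2 hpr)] using this
    · filter_upwards [h, ae_all_iff.2 fun n => AEEqFun.coeFn_sub (x n) a] with ω h1 h2
      simp only [h2, Pi.sub_apply]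
      simpa using h1.sub_const (a ω)
    · intro n
      filter_upwards [h, ae_all_iff.2 hx, AEEqFun.coeFn_sub (x n) a] with ω h1 h2 h3
      rw [h3, Pi.sub_apply]
      exact (norm_sub_le _ _).trans
        (add_le_add (h2 n) (le_of_tendsto h1.norm (Eventually.of_forall h2)))

theorem TendstoLp.tendsto0 (hp : 1 ≤ p) {x : ℕ → RV P d} {a : RV P d}
    (h : TendstoLp P p H x a) : Tendsto0 P x a := by
  have hp0 : p ≠ 0 := (zero_lt_one.trans_le hp).ne'
  unfold TendstoLp at h
  split_ifs at h with htop
  · exact h.2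
  · refine tendstoInMeasure_of_tendsto_eLpNorm hp0 (fun n => (x n).aestronglyMeasurable)
      a.aestronglyMeasurable (h.congr fun n => eLpNorm_congr_ae (AEEqFun.coeFn_sub _ _))

theorem exists_measurableSet_le_of_measurable [IsProbabilityMeasure P] (hH : H ≤ mΩ) {c : Ω → ℝ}
    (hc : Measurable[H] c) {ε : ℝ} (hε : 0 < ε) :
    ∃ k : ℕ, P {ω | c ω ≤ k}ᶜ ≤ ENNReal.ofReal ε := by
  have hm : ∀ k : ℕ, MeasurableSet {ω | c ω ≤ k}ᶜ := fun k =>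
    hH _ (MeasurableSet.compl (hc measurableSet_Iic))
  have h1 := tendsto_measure_iInter_atTop (μ := P) (s := fun k : ℕ => {ω | c ω ≤ k}ᶜ)
    (fun k => (hm k).nullMeasurableSet) ?_ ⟨0, measure_ne_top _ _⟩
  · have h2 : ⋂ k : ℕ, {ω | c ω ≤ k}ᶜ = ∅ := by
      ext ω
      simp only [Set.mem_iInter, Set.mem_compl_iff, Set.mem_ofPred_eq, not_le,
        Set.mem_empty_iff_false, iff_false, not_forall, not_lt]
      exact exists_nat_ge _
    rw [h2, measure_empty] at h1
    exact (h1.eventually_le_const (ENNReal.ofReal_pos.2 hε)).exists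
  · intro i j hij ω hω
    simp only [Set.mem_compl_iff, Set.mem_ofPred_eq, not_le] at hω ⊢
    exact lt_of_le_of_lt (by exact_mod_cast hij) hω

/-- A sequence that converges in the sense of `TendstoLp` has a subsequence that converges almost
surely and is dominated in `L^p` outside a measurable set of small probability. -/
theorem TendstoLp.exists_dominated_subseq [IsProbabilityMeasure P] (hH : H ≤ mΩ) (hp : 1 ≤ p)
    {x : ℕ → RV P d} {a : RV P d} (h : TendstoLp P p H x a) {ε : ℝ} (hε : 0 < ε) :
    ∃ φ : ℕ → ℕ, StrictMono φ ∧ (∀ᵐ ω ∂P, Tendsto (fun n => x (φ n) ω) atTop (𝓝 (a ω))) ∧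
      ∃ B : Set Ω, MeasurableSet[H] B ∧ P Bᶜ ≤ ENNReal.ofReal ε ∧ ∃ g : Ω → ℝ, MemLp g p P ∧
        ∀ n, ∀ᵐ ω ∂P, ω ∈ B → ‖x (φ n) ω - a ω‖ ≤ g ω := by
  have hp0 : p ≠ 0 := (zero_lt_one.trans_le hp).ne'
  obtain ⟨φ, hφ, hφa⟩ := (TendstoLp.tendsto0 hp h).exists_seq_tendsto_ae
  unfold TendstoLp at h
  split_ifs at h with htop
  · subst htop
    refine ⟨φ, hφ, hφa, ?_⟩
    obtain ⟨⟨c, hc, hxc⟩, -⟩ := h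
    obtain ⟨k, hk⟩ := exists_measurableSet_le_of_measurable (P := P) hH hc hε
    -- For `p = ∞` the bound `c` is only `H`-measurable, so a constant dominates only on an event `c
    -- ≤ k`; this event is `H`-measurable and can later serve as a convexity weight.
    refine ⟨{ω | c ω ≤ k}, hc measurableSet_Iic, hk,
      fun _ => k + k, memLp_const _, fun n => ?_⟩
    filter_upwards [hφa, ae_all_iff.2 hxc] with ω h1 h2 h3
    exact (norm_sub_le _ _).trans (add_le_add ((h2 _).trans h3)
        (le_of_tendsto h1.norm (Eventually.of_forall fun n => (h2 _).trans h3)))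
  · have hpr : 0 < p.toReal := ENNReal.toReal_pos hp0 htop
    have h1 : Tendsto (fun n => ∫⁻ ω, ‖(x (φ n) - a) ω‖ₑ ^ p.toReal ∂P) atTop (𝓝 0) := by
      have := ((ENNReal.continuous_rpow_const (y := p.toReal)).tendsto _).comp
        (h.comp hφ.tendsto_atTop)
      rw [ENNReal.zero_rpow_of_pos hpr] at this
      refine this.congr fun n => ?_
      simp only [Function.comp]
      rw [eLpNorm_eq_lintegral_rpow_enorm_toReal hp0 htop, ← ENNReal.rpow_mul, one_div,
        inv_mul_cancel₀ hpr.ne', ENNReal.rpow_one]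
    -- Summable `p`-th moments make the `p`-th root of the sum of all `p`-th powers a dominating
    -- function in `L^p`, with no exceptional event.
    obtain ⟨ψ, hψ, hψi⟩ := extraction_forall_of_eventually' (P := fun n k =>
      ∫⁻ ω, ‖(x (φ k) - a) ω‖ₑ ^ p.toReal ∂P ≤ ENNReal.ofReal ((1 / 2) ^ n)) fun n =>
        eventually_atTop.1 (h1.eventually_le_const (ENNReal.ofReal_pos.2 (by positivity)))
    refine ⟨φ ∘ ψ, hφ.comp hψ, ?_, Set.univ, MeasurableSet.univ, by simp, ?_⟩
    · filter_upwards [hφa] with ω hω using hω.comp hψ.tendsto_atTop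
    have hm : ∀ n, AEMeasurable (fun ω => ‖(x (φ (ψ n)) - a) ω‖ₑ ^ p.toReal) P := fun n =>
      (x (φ (ψ n)) - a).aestronglyMeasurable.enorm.pow_const _
    have hfin : ∫⁻ ω, ∑' n, ‖(x (φ (ψ n)) - a) ω‖ₑ ^ p.toReal ∂P ≠ ∞ := by
      rw [lintegral_tsum hm]
      refine ne_top_of_le_ne_top ?_ (ENNReal.tsum_le_tsum hψi)
      rw [← ENNReal.ofReal_tsum_of_nonneg (fun n => by positivity) summable_geometric_two]
      exact ENNReal.ofReal_ne_top
    have hlt := ae_lt_top' (AEMeasurable.tsum hm) hfin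
    refine ⟨fun ω => ((∑' n, ‖(x (φ (ψ n)) - a) ω‖ₑ ^ p.toReal) ^ (1 / p.toReal)).toReal,
      ⟨((AEMeasurable.tsum hm).pow_const _).ennreal_toReal.aestronglyMeasurable, ?_⟩, ?_⟩
    · rw [eLpNorm_lt_top_iff_lintegral_rpow_enorm_lt_top hp0 htop]
      refine lt_of_le_of_lt (lintegral_mono_ae ?_) hfin.lt_top
      filter_upwards [hlt] with ω hω
      have hne := (ENNReal.rpow_lt_top_of_nonneg (y := 1 / p.toReal) (by positivity) hω.ne).ne
      rw [Real.enorm_of_nonneg ENNReal.toReal_nonneg, ENNReal.ofReal_toReal hne,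
        ← ENNReal.rpow_mul, one_div, inv_mul_cancel₀ hpr.ne', ENNReal.rpow_one]
    · intro n
      filter_upwards [hlt, AEEqFun.coeFn_sub (x (φ (ψ n))) a] with ω hω hs _
      have hne := (ENNReal.rpow_lt_top_of_nonneg (y := 1 / p.toReal) (by positivity) hω.ne).ne
      have hs' : ‖x ((φ ∘ ψ) n) ω - a ω‖ = (‖(x (φ (ψ n)) - a) ω‖ₑ).toReal := by
        rw [toReal_enorm, hs]; rfl
      rw [hs']
      refine ENNReal.toReal_mono hne ?_
      have := ENNReal.rpow_le_rpow (ENNReal.le_tsum (f := fun n =>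
        ‖(x (φ (ψ n)) - a) ω‖ₑ ^ p.toReal) n) (z := 1 / p.toReal) (by positivity)
      rwa [← ENNReal.rpow_mul, mul_one_div_cancel hpr.ne', ENNReal.rpow_one] at this

end Integrability

/-! ### Attainable positions and their relation to endowments. -/

section Attainable

variable {Ω : Type*} {H mΩ : MeasurableSpace Ω} {P : Measure Ω} {ℱ : Filtration ℕ mΩ} {T d : ℕ}
  {p : ℝ≥0∞} {C : ℕ → ℕ → Set (RV P d)} {K : ℕ → Ω → Set (Vec d)}

theorem neg_mem_L0Sel_neg_iff {X : Ω → Set (Vec d)} {ξ : RV P d} :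
    -ξ ∈ L0Sel P H (fun ω => -(X ω)) ↔ ξ ∈ L0Sel P H X := by
  refine and_congr neg_mem_L0_iff ⟨fun h => ?_, fun h => ?_⟩
  all_goals filter_upwards [h, AEEqFun.coeFn_neg ξ] with ω h1 h2
  · rw [h2] at h1
    simpa using h1
  · rw [h2]
    simpa using h1

theorem zero_mem_L0Sel {X : Ω → Set (Vec d)}
    (h : ∀ᵐ ω ∂P, (0 : Vec d) ∈ X ω) : (0 : RV P d) ∈ L0Sel P H X := by
  refine ⟨zero_mem_L0, ?_⟩
  filter_upwards [h, AEEqFun.coeFn_zero (μ := P) (β := Vec d)] with ω h1 h2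
  rw [h2]
  exact h1

theorem IsAcceptanceFamily.zero_mem (hC : IsAcceptanceFamily P ℱ T p C) {t s : ℕ} (hts : t ≤ s)
    (hsT : s ≤ T) : (0 : RV P d) ∈ C t s :=
  hC.nonneg_subset t s hts hsT (zero_mem_L0Sel (by simp [posOrthant]))

theorem posOrthant_add {x y : Vec d} (hx : x ∈ posOrthant d) (hy : y ∈ posOrthant d) :
    x + y ∈ posOrthant d :=
  fun i => add_nonneg (hx i) (hy i)

theorem IsAcceptanceFamily.add_mem (hC : IsAcceptanceFamily P ℱ T p C) {t s : ℕ} (hts : t ≤ s)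
    (hsT : s ≤ T) {η z : RV P d} (hη : η ∈ C t s)
    (hz : z ∈ L0Sel P (ℱ s) (fun _ => posOrthant d)) : η + z ∈ C t s := by
  rw [hC.integrability t s hts hsT] at hη ⊢
  obtain ⟨a, ha, b, hb, rfl⟩ := hη
  refine ⟨a, ha, b + z, ⟨add_mem_L0 hb.1 hz.1, ?_⟩, (add_assoc _ _ _).symm⟩
  filter_upwards [hb.2, hz.2, AEEqFun.coeFn_add b z] with ω h1 h2 h3
  rw [h3]
  exact posOrthant_add h1 h2

theorem IsAcceptanceFamily.subset_L0 (hC : IsAcceptanceFamily P ℱ T p C) {t s : ℕ} (hts : t ≤ s)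
    (hsT : s ≤ T) : C t s ⊆ L0 P (ℱ s) := by
  intro η hη
  obtain ⟨a, ha, b, hb, rfl⟩ := hC.subset_bar t s hts hsT hη
  exact add_mem_L0 ha.1 hb.1

theorem IsAcceptanceFamily.condConvex (hC : IsAcceptanceFamily P ℱ T p C) {t s : ℕ} (hts : t ≤ s)
    (hsT : s ≤ T) : CondConvex P (ℱ t) (C t s) :=
  hC.cond_convex t s hts hsT

theorem IsSolvencyFamily.zero_mem (hK : IsSolvencyFamily P ℱ T K) {t : ℕ} (ht : t ≤ T) :
    ∀ᵐ ω ∂P, (0 : Vec d) ∈ K t ω := by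
  filter_upwards [hK.inter_nonpos t ht] with ω hω
  exact (hω.symm.subset rfl).1

theorem attainable_self : attainable P ℱ C K T T = L0Sel P (ℱ T) (fun ω => -(K T ω)) := by
  simp [attainable]

theorem attainable_of_lt {t : ℕ} (ht : t < T) :
    attainable P ℱ C K t T =
      L0Sel P (ℱ t) (fun ω => -(K t ω)) - C t (t + 1) + attainable P ℱ C K (t + 1) T := by
  have h : ∑ u ∈ Finset.Icc t T, L0Sel P (ℱ u) (fun ω => -(K u ω)) =
      L0Sel P (ℱ t) (fun ω => -(K t ω)) +
        ∑ u ∈ Finset.Icc (t + 1) T, L0Sel P (ℱ u) (fun ω => -(K u ω)) := by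
    rw [← Finset.sum_Ioc_add_eq_sum_Icc ht.le, add_comm, ← Finset.Icc_add_one_left_eq_Ioc]
  rw [attainable, attainable, h, Finset.sum_eq_sum_Ico_succ_bot ht]
  exact add_sub_add_comm _ _ _ _

theorem mem_attainable_of_lt {t : ℕ} (ht : t < T) {x : RV P d} :
    x ∈ attainable P ℱ C K t T ↔ ∃ k ∈ L0Sel P (ℱ t) (K t), ∃ c ∈ C t (t + 1),
      ∃ a ∈ attainable P ℱ C K (t + 1) T, x = a - k - c := by
  rw [attainable_of_lt ht]
  constructor
  · rintro ⟨_, ⟨k, hk, c, hc, rfl⟩, a, ha, rfl⟩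
    refine ⟨-k, neg_mem_L0Sel_neg_iff.1 (by simpa using hk), c, hc, a, ha, ?_⟩
    simp only [sub_neg_eq_add]
    abel
  · rintro ⟨k, hk, c, hc, a, ha, rfl⟩
    refine ⟨_, ⟨-k, neg_mem_L0Sel_neg_iff.2 hk, c, hc, rfl⟩, a, ha, ?_⟩
    simp only
    abel

theorem zero_mem_attainable (hC : IsAcceptanceFamily P ℱ T p C) (hK : IsSolvencyFamily P ℱ T K)
    {t : ℕ} (ht : t ≤ T) : (0 : RV P d) ∈ attainable P ℱ C K t T := by
  induction ht using Nat.decreasingInduction with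
  | self =>
    rw [attainable_self, ← neg_zero, neg_mem_L0Sel_neg_iff]
    exact zero_mem_L0Sel (hK.zero_mem le_rfl)
  | of_succ t ht ih =>
    exact (mem_attainable_of_lt ht).2 ⟨0, zero_mem_L0Sel (hK.zero_mem ht.le), 0,
      hC.zero_mem t.le_succ ht, 0, ih, by simp⟩

theorem condConvex_attainable (hC : IsAcceptanceFamily P ℱ T p C) (hK : IsSolvencyFamily P ℱ T K)
    {t : ℕ} (ht : t ≤ T) : CondConvex P (ℱ t) (attainable P ℱ C K t T) := by
  have hsel : ∀ t ≤ T, CondConvex P (ℱ t) (L0Sel P (ℱ t) (fun ω => -(K t ω))) := by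
    intro t ht
    refine condConvex_L0Sel P le_rfl ?_
    filter_upwards [hK.convex t ht] with ω hω using hω.neg
  induction ht using Nat.decreasingInduction with
  | self => rw [attainable_self]; exact hsel T le_rfl
  | of_succ t ht ih =>
    rw [attainable_of_lt ht, sub_eq_add_neg]
    exact ((hsel t ht.le).add (ℱ.le t) (hC.condConvex t.le_succ ht).neg).add (ℱ.le t)
      (ih.mono (ℱ.mono t.le_succ))

/-- The subtracted nonnegative vector is carried through the recursion to the terminal time, where
the upper set `K T` absorbs it. -/
theorem sub_mem_attainable (hK : IsSolvencyFamily P ℱ T K) {t : ℕ} (ht : t ≤ T) {a z : RV P d}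
    (ha : a ∈ attainable P ℱ C K t T) (hz : z ∈ L0Sel P (ℱ T) (fun _ => posOrthant d)) :
    a - z ∈ attainable P ℱ C K t T := by
  induction ht using Nat.decreasingInduction generalizing a with
  | self =>
    rw [attainable_self] at ha ⊢
    refine ⟨sub_mem_L0 ha.1 hz.1, ?_⟩
    filter_upwards [ha.2, hz.2, hK.upper T le_rfl, AEEqFun.coeFn_sub a z] with ω h1 h2 h3 h4
    rw [h4, Pi.sub_apply, Set.mem_neg, neg_sub]
    have := h3 (Set.add_mem_add (Set.mem_neg.1 h1) h2)
    rwa [neg_add_eq_sub] at this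
  | of_succ t ht ih =>
    obtain ⟨k, hk, c, hc, b, hb, rfl⟩ := (mem_attainable_of_lt ht).1 ha
    exact (mem_attainable_of_lt ht).2 ⟨k, hk, c, hc, b - z, ih hb, by abel⟩

theorem endow_self : endow P ℱ T C K T = L0Sel P (ℱ T) (K T) := by
  rw [endow, if_neg (lt_irrefl _)]

theorem endow_of_lt {t : ℕ} (ht : t < T) : endow P ℱ T C K t =
    L0Sel P (ℱ t) (K t) + selRisk0 P ℱ C t (t + 1) (endow P ℱ T C K (t + 1)) := by
  rw [endow, if_pos ht]

/-- The measurability imposed on the intermediate endowments costs nothing: if the total is `ℱ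
t`-measurable, then removing an `ℱ t`-measurable selection and an `ℱ (t + 1)`-measurable acceptable
position leaves an `ℱ (t + 1)`-measurable remainder. -/
theorem mem_endow_iff (hC : IsAcceptanceFamily P ℱ T p C) {t : ℕ} (ht : t ≤ T) {ξ : RV P d} :
    ξ ∈ endow P ℱ T C K t ↔ -ξ ∈ attainable P ℱ C K t T ∩ L0 P (ℱ t) := by
  induction ht using Nat.decreasingInduction generalizing ξ with
  | self =>
    rw [endow_self, attainable_self]
    exact ⟨fun h => ⟨neg_mem_L0Sel_neg_iff.2 h, neg_mem_L0 h.1⟩,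
      fun h => neg_mem_L0Sel_neg_iff.1 h.1⟩
  | of_succ t ht ih =>
    rw [endow_of_lt ht, Set.mem_inter_iff, neg_mem_L0_iff, mem_attainable_of_lt ht]
    constructor
    · rintro ⟨k, hk, r, ⟨hr, η, hη, hc⟩, rfl⟩
      exact ⟨⟨k, hk, _, hc, -η, (ih.1 hη).1, by rw [neg_add]; abel⟩, add_mem_L0 hk.1 hr⟩
    · rintro ⟨⟨k, hk, c, hc, a, ha, h⟩, hξ⟩
      have haξ : a = -(ξ - k - c) := by rw [eq_comm, sub_sub, sub_eq_iff_eq_add] at h; rw [h]; abel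
      refine ⟨k, hk, ξ - k, ⟨sub_mem_L0 hξ hk.1, ξ - k - c, ih.2 ⟨haξ ▸ ha, neg_mem_L0 ?_⟩, ?_⟩,
        by simp⟩
      · exact sub_mem_L0 (L0_mono (ℱ.mono t.le_succ) (sub_mem_L0 hξ hk.1))
          (hC.subset_L0 t.le_succ ht hc)
      · simpa using hc

end Attainable

/-! ### Compensating decreasing sequences through continuity from below. -/

section Compensation

variable {Ω : Type*} {H mΩ : MeasurableSpace Ω} {P : Measure Ω} {d : ℕ} {p : ℝ≥0∞}

/-- `H`-measurable random vectors decreasing to zero almost surely, the first of which is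
`p`-integrable. -/
structure DecreasesToZero (P : Measure Ω) (p : ℝ≥0∞) (H : MeasurableSpace Ω) (x : ℕ → RV P d) :
    Prop where
  mem_L0 : ∀ n, x n ∈ L0 P H
  memLp : MemLp (x 0) p P
  ae : ∀ᵐ ω ∂P, ∀ i, Antitone (fun n => x n ω i) ∧ Tendsto (fun n => x n ω i) atTop (𝓝 0)

theorem norm_le_of_coord_le {x y : Vec d} (h0 : ∀ i, 0 ≤ x i) (h : ∀ i, x i ≤ y i) :
    ‖x‖ ≤ ‖y‖ := by
  rw [EuclideanSpace.norm_eq, EuclideanSpace.norm_eq]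
  refine Real.sqrt_le_sqrt (Finset.sum_le_sum fun i _ => ?_)
  rw [Real.norm_of_nonneg (h0 i), Real.norm_of_nonneg ((h0 i).trans (h i))]
  exact pow_le_pow_left₀ (h0 i) (h i) 2

theorem tendsto_vec_iff {x : ℕ → Vec d} {a : Vec d} :
    Tendsto x atTop (𝓝 a) ↔ ∀ i, Tendsto (fun n => x n i) atTop (𝓝 (a i)) := by
  refine ⟨fun h i => ((EuclideanSpace.proj (𝕜 := ℝ) i).continuous.tendsto a).comp h, fun h => ?_⟩
  exact ((PiLp.continuous_toLp 2 fun _ : Fin d => ℝ).tendsto _).comp (tendsto_pi_nhds.2 h)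

theorem measurable_coord {g : Ω → Vec d} (hg : Measurable[H] g) (i : Fin d) :
    Measurable[H] fun ω => g ω i :=
  (EuclideanSpace.proj (𝕜 := ℝ) i).continuous.measurable.comp hg

/-- The vector all of whose coordinates are one. -/
def oneVec (d : ℕ) : Vec d := WithLp.toLp 2 fun _ => 1

@[simp] theorem oneVec_apply (i : Fin d) : oneVec d i = 1 := rfl

theorem smul_oneVec_apply (r : ℝ) (i : Fin d) : (r • oneVec d) i = r := by simp

theorem DecreasesToZero.nonneg {x : ℕ → RV P d} (hx : DecreasesToZero P p H x) :
    ∀ᵐ ω ∂P, ∀ n i, 0 ≤ x n ω i := by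
  filter_upwards [hx.ae] with ω hω n i using (hω i).1.le_of_tendsto (hω i).2 n

theorem DecreasesToZero.norm_le {x : ℕ → RV P d} (hx : DecreasesToZero P p H x) :
    ∀ᵐ ω ∂P, ∀ n, ‖x n ω‖ ≤ ‖x 0 ω‖ := by
  filter_upwards [hx.ae, hx.nonneg] with ω hω h0 n
  exact norm_le_of_coord_le (h0 n) fun i => (hω i).1 n.zero_le

theorem DecreasesToZero.tendsto {x : ℕ → RV P d} (hx : DecreasesToZero P p H x) :
    ∀ᵐ ω ∂P, Tendsto (fun n => x n ω) atTop (𝓝 0) := by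
  filter_upwards [hx.ae] with ω hω
  exact tendsto_vec_iff.2 fun i => (hω i).2

variable {ℱ : Filtration ℕ mΩ} {T : ℕ} {C : ℕ → ℕ → Set (RV P d)} {K : ℕ → Ω → Set (Vec d)}

/-- Continuity from below, applied to `-x n ↑ 0`, gives decreasing compensators whose first term
might fail to be `p`-integrable. They are therefore capped by means of a `p`-integrable compensator
`g` of `x 0`, which keeps the construction iterable in time. -/
theorem exists_compensator [IsProbabilityMeasure P] (hp : 1 ≤ p)
    (hC : IsAcceptanceFamily P ℱ T p C) (hcont : ContinuousFromBelow P ℱ T p C) {t s : ℕ}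
    (hts : t ≤ s) (hsT : s ≤ T) {x : ℕ → RV P d} (hx : DecreasesToZero P p (ℱ s) x) :
    ∃ γ : ℕ → RV P d, DecreasesToZero P p (ℱ t) γ ∧ ∀ n, γ n - x n ∈ C t s := by
  have hneg : ∀ᵐ ω ∂P, ∀ n, (-x n) ω = -(x n ω) :=
    ae_all_iff.2 fun n => AEEqFun.coeFn_neg (x n)
  have hxLp : ∀ n, MemLp (-x n : RV P d) p P := fun n => by
    refine hx.memLp.of_le (-x n).aestronglyMeasurable ?_
    filter_upwards [hneg, hx.norm_le] with ω h1 h2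
    rw [h1, norm_neg]
    exact h2 n
  have hmono : ∀ᵐ ω ∂P, ∀ i, Monotone (fun n => (-x n) ω i) ∧
      Tendsto (fun n => (-x n) ω i) atTop (𝓝 ((0 : RV P d) ω i)) := by
    filter_upwards [hx.ae, hneg, AEEqFun.coeFn_zero (μ := P) (β := Vec d)] with ω h1 h2 h3 i
    simp only [h2, h3]
    refine ⟨fun m n hmn => neg_le_neg ((h1 i).1 hmn), by simpa using (h1 i).2.neg⟩
  have hconv : TendstoCondLp P p (ℱ t) (fun n => -x n) 0 := by
    refine tendstoCondLp_zero_of_dominated (ℱ.le t) hp ?_ hx.memLp.norm fun n => ?_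
    · filter_upwards [hx.tendsto, hneg] with ω h1 h2
      simp only [h2]
      simpa using h1.neg
    · filter_upwards [hneg, hx.norm_le] with ω h1 h2
      rw [h1, norm_neg]
      exact h2 n
  have hzero : (0 : RV P d) ∈ CondLp P p (ℱ t) (ℱ s) := LpFam_subset_CondLp hp
    ⟨zero_mem_L0, (memLp_congr_ae AEEqFun.coeFn_zero).2 MemLp.zero⟩
  obtain ⟨γ, hγ, hγC, hγ0, -⟩ := hcont t s hts hsT (fun n => -x n) 0
    (fun n => LpFam_subset_CondLp hp ⟨neg_mem_L0 (hx.mem_L0 n), hxLp n⟩)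
    ⟨hC.zero_mem hts hsT, hzero⟩ hmono hconv
  obtain ⟨g, ⟨_, rfl, c, hc, rfl⟩, hgm, hgLp⟩ := hC.compensation_Lp t s hts hsT (x 0)
    ⟨hx.mem_L0 0, hx.memLp⟩
  simp only at hgm hgLp
  obtain ⟨g, hg, hgeq⟩ := exists_measurable_rep hgm
  choose f hf hfeq using fun n => exists_measurable_rep (hγ n).1
  have hrm : Measurable[ℱ t] fun ω => (‖g ω‖ + 1) • oneVec d :=
    ((measurable_norm.comp hg).add_const 1).smul_const _
  -- The cap dominates `g` in every coordinate, and `x n ≤ x 0`, so `R` compensates every `x n`.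
  obtain ⟨R, hR, hReq⟩ := exists_mem_L0 P (ℱ.le t) hrm
  have hRC : ∀ n, R - x n ∈ C t s := by
    intro n
    have h1 : R - x n = c + (R - x n - c) := by abel
    rw [h1]
    refine hC.add_mem hts hsT hc ⟨sub_mem_L0 (sub_mem_L0 (L0_mono (ℱ.mono hts) hR) (hx.mem_L0 n))
      (hC.subset_L0 hts hsT hc), ?_⟩
    filter_upwards [hx.ae, hReq, hgeq, AEEqFun.coeFn_add (x 0) c, AEEqFun.coeFn_sub (R - x n) c,
      AEEqFun.coeFn_sub R (x n)] with ω e1 e2 e3 e4 e5 e6 i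
    rw [e5, Pi.sub_apply, e6, Pi.sub_apply, e2]
    have h2 : g ω i = x 0 ω i + c ω i := by rw [← e3, e4]; rfl
    have h3 : g ω i ≤ ‖g ω‖ := (le_abs_self _).trans (PiLp.norm_apply_le (g ω) i)
    have h4 := (e1 i).1 n.zero_le
    simp only [PiLp.sub_apply, smul_oneVec_apply]
    linarith
  -- Where `γ n` fits under the cap it is kept, elsewhere it is replaced by `R`; conditional
  -- convexity permits this switching. The events increase with `n`, so monotonicity survives, and
  -- since the cap is strictly positive they eventually contain almost every point.
  let A : ℕ → Set Ω := fun n => {ω | ∀ i, f n ω i ≤ ‖g ω‖ + 1}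
  have hA : ∀ n, MeasurableSet[ℱ t] (A n) := fun n => by
    have : A n = ⋂ i, {ω | f n ω i ≤ ‖g ω‖ + 1} := by ext; simp [A]
    rw [this]
    exact MeasurableSet.iInter fun i => measurableSet_le (measurable_coord (hf n) i)
      ((measurable_norm.comp hg).add_const 1)
  let α : ℕ → Ω → ℝ := fun n => (A n).indicator fun _ => 1
  have hα : ∀ n, Measurable[ℱ t] (α n) := fun n => Measurable.indicator measurable_const (hA n)
  have hα01 : ∀ n ω, 0 ≤ α n ω ∧ α n ω ≤ 1 := fun n ω => by
    by_cases h : ω ∈ A n <;> simp [α, h]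
  have hm : ∀ n, Measurable[ℱ t] fun ω =>
      α n ω • f n ω + (1 - α n ω) • (‖g ω‖ + 1) • oneVec d := fun n =>
    ((hα n).smul (hf n)).add ((measurable_const.sub (hα n)).smul hrm)
  choose δ hδ hδeq using fun n => exists_mem_L0 P (ℱ.le t) (hm n)
  have hpos : ∀ᵐ ω ∂P, ∀ n i, 0 ≤ f n ω i := by
    refine ae_all_iff.2 fun n => ?_
    filter_upwards [hfeq n, (hγ n).2] with ω h1 h2
    rw [← h1]
    exact h2
  have hin : ∀ n ω, ω ∈ A n →
      α n ω • f n ω + (1 - α n ω) • (‖g ω‖ + 1) • oneVec d = f n ω := fun n ω h => by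
    simp [α, h]
  have hout : ∀ n ω, ω ∉ A n →
      α n ω • f n ω + (1 - α n ω) • (‖g ω‖ + 1) • oneVec d = (‖g ω‖ + 1) • oneVec d :=
    fun n ω h => by simp [α, h]
  refine ⟨δ, ⟨hδ, ?_, ?_⟩, fun n => ?_⟩
  · have hgLp' : MemLp (fun ω => ‖g ω‖ + 1) p P :=
      ((memLp_congr_ae hgeq).1 hgLp).norm.add (memLp_const 1)
    refine hgLp'.of_le_mul (c := ‖oneVec d‖) (δ 0).aestronglyMeasurable ?_
    filter_upwards [hδeq 0, hpos] with ω h1 h2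
    rw [h1]
    have h3 : ‖oneVec d‖ * ‖‖g ω‖ + 1‖ = ‖(‖g ω‖ + 1) • oneVec d‖ := by
      rw [norm_smul, mul_comm]
    rw [h3]
    by_cases h : ω ∈ A 0
    · rw [hin 0 ω h]
      exact norm_le_of_coord_le (h2 0) fun i => by rw [smul_oneVec_apply]; exact h i
    · rw [hout 0 ω h]
  · filter_upwards [ae_all_iff.2 hδeq, hγ0, ae_all_iff.2 hfeq] with ω h1 h2 h3 i
    simp only [h3] at h2
    simp only [h1]
    have hmono : ∀ m n, m ≤ n → ω ∈ A m → ω ∈ A n := fun m n hmn h j =>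
      ((h2 j).1 hmn).trans (h j)
    have hev : ∀ᶠ n in atTop, ω ∈ A n := by
      refine eventually_all.2 fun j => (h2 j).2.eventually_le_const ?_
      positivity
    constructor
    · intro m n hmn
      simp only
      by_cases h : ω ∈ A m
      · rw [hin m ω h, hin n ω (hmono m n hmn h)]
        exact (h2 i).1 hmn
      · rw [hout m ω h]
        by_cases h' : ω ∈ A n
        · rw [hin n ω h', smul_oneVec_apply]
          exact h' i
        · rw [hout n ω h']
    · refine (h2 i).2.congr' ?_
      filter_upwards [hev] with n hn
      rw [hin n ω hn]
  · refine hC.cond_convex t s hts hsT (α n) (hα n) (hα01 n) _ (hγC n) _ (hRC n) _ ?_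
    filter_upwards [hδeq n, hfeq n, hReq, hneg, AEEqFun.coeFn_sub (δ n) (x n),
      AEEqFun.coeFn_add (γ n) (-x n), AEEqFun.coeFn_sub R (x n)] with ω e1 e2 e3 e4 e5 e6 e7
    rw [e5, e6, e7, Pi.sub_apply, Pi.add_apply, Pi.sub_apply, e1, e2, e3, e4]
    module

/-- Backward induction in time: compensators at `t + 1` are themselves a decreasing sequence to be
compensated one step earlier, and the differences telescope. -/
theorem exists_attainable_compensator [IsProbabilityMeasure P] (hp : 1 ≤ p)
    (hC : IsAcceptanceFamily P ℱ T p C) (hcont : ContinuousFromBelow P ℱ T p C)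
    (hK : IsSolvencyFamily P ℱ T K) {t : ℕ} (ht : t ≤ T) {x : ℕ → RV P d}
    (hx : DecreasesToZero P p (ℱ T) x) :
    ∃ γ : ℕ → RV P d, DecreasesToZero P p (ℱ t) γ ∧
      ∀ n, x n - γ n ∈ attainable P ℱ C K t T := by
  induction ht using Nat.decreasingInduction with
  | self => exact ⟨x, hx, fun n => by simpa using zero_mem_attainable hC hK le_rfl⟩
  | of_succ t ht ih =>
    obtain ⟨γ, hγ, h⟩ := ih
    obtain ⟨γ', hγ', h'⟩ := exists_compensator hp hC hcont t.le_succ ht hγ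
    exact ⟨γ', hγ', fun n => (mem_attainable_of_lt ht).2 ⟨0, zero_mem_L0Sel (hK.zero_mem ht.le), _,
      h' n, _, h n, by abel⟩⟩

end Compensation

/-! ### From `L^p`-type closures to closures in probability, and back. -/

section Compensable

variable {Ω : Type*} {H G mΩ : MeasurableSpace Ω} {P : Measure Ω} {d : ℕ} {p : ℝ≥0∞}
  {A : Set (RV P d)}

/-- Random vectors that enter `A` after scaling by `H`-measurable weights close to one and
subtracting small `H`-measurable random vectors. -/
def compensable (P : Measure Ω) (H : MeasurableSpace Ω) (A : Set (RV P d)) : Set (RV P d) :=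
  {ξ | ∀ ε : ℝ, 0 < ε → ∃ l : Ω → ℝ, Measurable[H] l ∧ (∀ ω, 0 ≤ l ω ∧ l ω ≤ 1) ∧
    ∃ γ ∈ L0 P H, ∃ N : Set Ω, P N ≤ ENNReal.ofReal ε ∧
      (∀ᵐ ω ∂P, ω ∉ N → 1 - l ω ≤ ε ∧ ‖γ ω‖ ≤ ε) ∧
      ∃ a ∈ A, ∀ᵐ ω ∂P, a ω = l ω • ξ ω - γ ω}

theorem subset_compensable : A ⊆ compensable P H A := by
  intro a ha ε hε
  refine ⟨fun _ => 1, measurable_const, fun _ => by simp, 0, zero_mem_L0, ∅, by simp, ?_, a, ha, ?_⟩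
  all_goals filter_upwards [AEEqFun.coeFn_zero (μ := P) (β := Vec d)] with ω h
  · simp [h, hε.le]
  · simp [h]

/-- When `ξ` is `H`-measurable, the approximants `l • ξ - γ` are `H`-measurable as well, and they
tend to `ξ` by Borel–Cantelli. -/
theorem mem_cl0_of_mem_compensable [IsFiniteMeasure P] {ξ : RV P d}
    (hξ : ξ ∈ compensable P H A) (hξH : ξ ∈ L0 P H) : ξ ∈ cl0 P (A ∩ L0 P H) := by
  choose l hl hl01 γ hγ N hN hlγ a ha haeq using fun n : ℕ => hξ ((1 / 2) ^ n) (by positivity)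
  refine mem_cl0_of_ae_tendsto (y := a) (fun n => subset_convClosure ⟨ha n, ?_⟩) ?_
  · obtain ⟨f, hf, hfeq⟩ := exists_measurable_rep hξH
    obtain ⟨g, hg, hgeq⟩ := exists_measurable_rep (hγ n)
    refine mem_L0_of_ae_eq (((hl n).smul hf).sub hg) ?_
    filter_upwards [haeq n, hfeq, hgeq] with ω h1 h2 h3
    rw [h1, h2, h3]
    rfl
  · have h2 : Tendsto (fun n : ℕ => (1 / 2 : ℝ) ^ n) atTop (𝓝 0) :=
      tendsto_pow_atTop_nhds_zero_of_lt_one (by norm_num) (by norm_num)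
    filter_upwards [ae_all_iff.2 haeq, ae_all_iff.2 hlγ, ae_eventually_notMem_of_le_half_pow hN]
      with ω h3 h4 h5
    have hl1 : Tendsto (fun n => 1 - l n ω) atTop (𝓝 0) := by
      refine squeeze_zero' (Eventually.of_forall fun n => sub_nonneg.2 (hl01 n ω).2) ?_ h2
      filter_upwards [h5] with n hn using (h4 n hn).1
    have hγ0 : Tendsto (fun n => γ n ω) atTop (𝓝 0) := by
      refine squeeze_zero_norm' ?_ h2
      filter_upwards [h5] with n hn using (h4 n hn).2
    have h6 : Tendsto (fun n => ξ ω - (1 - l n ω) • ξ ω - γ n ω) atTop (𝓝 (ξ ω)) := by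
      simpa using ((hl1.smul_const (ξ ω)).const_sub (ξ ω)).sub hγ0
    refine h6.congr fun n => ?_
    rw [h3]
    module

/-- Elements of the closure in probability belong, after restriction to suitable measurable sets
exhausting the space, to the closure of the `p`-integrable elements. -/
theorem exists_localization_of_mem_cl0 [IsProbabilityMeasure P] (hp : 1 ≤ p) (hH : H ≤ mΩ)
    (hHG : H ≤ G) (h0 : (0 : RV P d) ∈ A) (hA : CondConvex P H A) {ξ : RV P d}
    (hξ : ξ ∈ cl0 P (A ∩ L0 P H)) :
    ∃ B : ℕ → Set Ω, (∀ k, MeasurableSet[H] (B k)) ∧ (∀ᵐ ω ∂P, ∃ k, ω ∈ B k) ∧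
      ∀ k, ∀ ζ : RV P d, (∀ᵐ ω ∂P, ζ ω = (B k).indicator ξ ω) →
        ζ ∈ clp P p H (A ∩ LpFam P p G) := by
  obtain ⟨y, hy, hyξ⟩ := exists_ae_tendsto_of_mem_cl0 hξ
  choose f hf hfeq using fun n => exists_measurable_rep (hy n).2
  -- A convergent sequence is bounded, so these events exhaust the space up to a null set.
  let B : ℕ → Set Ω := fun k => {ω | ∀ n, ‖f n ω‖ ≤ k}
  have hB : ∀ k, MeasurableSet[H] (B k) := fun k => by
    have : B k = ⋂ n, {ω | ‖f n ω‖ ≤ k} := by ext; simp [B]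
    rw [this]
    exact MeasurableSet.iInter fun n => (measurable_norm.comp (hf n)) measurableSet_Iic
  refine ⟨B, hB, ?_, fun k ζ hζ => ?_⟩
  · filter_upwards [hyξ, ae_all_iff.2 hfeq] with ω h1 h2
    obtain ⟨c, hc⟩ := h1.norm.bddAbove_range
    obtain ⟨k, hk⟩ := exists_nat_ge c
    refine ⟨k, fun n => ?_⟩
    rw [← h2]
    exact (hc ⟨n, rfl⟩).trans hk
  have hbm : ∀ n, Measurable[H] ((B k).indicator (f n)) := fun n => (hf n).indicator (hB k)
  choose w hw hweq using fun n => exists_mem_L0 P hH (hbm n)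
  have hα : Measurable[H] ((B k).indicator fun _ => (1 : ℝ)) :=
    Measurable.indicator measurable_const (hB k)
  have hα01 : ∀ ω, 0 ≤ (B k).indicator (fun _ => (1 : ℝ)) ω ∧
      (B k).indicator (fun _ => (1 : ℝ)) ω ≤ 1 := fun ω => by
    by_cases h : ω ∈ B k <;> simp [h]
  have hbd : ∀ n, ∀ᵐ ω ∂P, ‖w n ω‖ ≤ k := by
    intro n
    filter_upwards [hweq n] with ω h
    rw [h]
    by_cases hω : ω ∈ B k
    · rw [Set.indicator_of_mem hω]
      exact hω n
    · rw [Set.indicator_of_notMem hω]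
      simp
  refine mem_convClosure_of_conv (x := w) (fun n => subset_convClosure ⟨?_, L0_mono hHG (hw n),
    MemLp.of_bound (w n).aestronglyMeasurable k (hbd n)⟩) (tendstoLp_of_bounded hp ?_ hbd)
  · refine hA.smul_mem h0 hα hα01 (hy n).1 ?_
    filter_upwards [hweq n, hfeq n] with ω h1 h2
    rw [h1, h2]
    by_cases hω : ω ∈ B k <;> simp [hω]
  · filter_upwards [hyξ, ae_all_iff.2 hweq, ae_all_iff.2 hfeq, hζ] with ω h1 h2 h3 h4
    simp only [h2, h4]
    by_cases hω : ω ∈ B k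
    · simpa [hω, h3] using h1
    · simp [hω]

/-- Tail suprema of a dominated sequence of nonnegative variables converging to zero. -/
theorem decreasesToZero_iSup [IsProbabilityMeasure P] (hG : G ≤ mΩ) {h : ℕ → Ω → ℝ}
    (hm : ∀ n, Measurable[G] (h n)) (h0 : ∀ n ω, 0 ≤ h n ω)
    (hlim : ∀ᵐ ω ∂P, Tendsto (fun n => h n ω) atTop (𝓝 0)) {g : Ω → ℝ} (hg : MemLp g p P)
    (hle : ∀ n, ∀ᵐ ω ∂P, h n ω ≤ g ω) {c : ℝ} (hc : 0 ≤ c) :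
    ∃ z : ℕ → RV P d, DecreasesToZero P p G z ∧ ∀ n, ∀ᵐ ω ∂P, ∀ i, c * h n ω ≤ z n ω i := by
  have hzm : ∀ n, Measurable[G] fun ω => (c * ⨆ j, h (n + j) ω) • oneVec d := fun n =>
    ((Measurable.iSup fun j => hm (n + j)).const_mul c).smul_const _
  choose z hz hzeq using fun n => exists_mem_L0 P hG (hzm n)
  have hbdd : ∀ᵐ ω ∂P, ∀ n, BddAbove (Set.range fun j => h (n + j) ω) := by
    filter_upwards [hlim] with ω h1 n
    exact h1.bddAbove_range.mono (by rintro _ ⟨j, rfl⟩; exact ⟨n + j, rfl⟩)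
  refine ⟨z, ⟨hz, ?_, ?_⟩, fun n => ?_⟩
  · refine (hg.const_mul c).of_le_mul (c := ‖oneVec d‖) (z 0).aestronglyMeasurable ?_
    filter_upwards [hzeq 0, ae_all_iff.2 hle] with ω h1 h2
    rw [h1, norm_smul, mul_comm]
    refine mul_le_mul_of_nonneg_left ?_ (norm_nonneg _)
    rw [Real.norm_of_nonneg (mul_nonneg hc (Real.iSup_nonneg fun j => h0 _ ω))]
    exact (mul_le_mul_of_nonneg_left (ciSup_le fun j => h2 _) hc).trans (le_abs_self _)
  · filter_upwards [ae_all_iff.2 hzeq, hbdd, hlim] with ω h1 h2 h3 i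
    simp only [h1, smul_oneVec_apply]
    constructor
    · intro m n hmn
      refine mul_le_mul_of_nonneg_left (ciSup_le fun j => ?_) hc
      refine le_trans (le_of_eq ?_) (le_ciSup (h2 m) (n - m + j))
      congr 1
      omega
    · have h4 : Tendsto (fun n => ⨆ j, h (n + j) ω) atTop (𝓝 0) := by
        rw [Metric.tendsto_atTop] at h3 ⊢
        intro δ hδ
        obtain ⟨M, hM⟩ := h3 (δ / 2) (half_pos hδ)
        refine ⟨M, fun n hn => ?_⟩
        rw [Real.dist_eq, sub_zero, abs_of_nonneg (Real.iSup_nonneg fun j => h0 _ ω)]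
        refine lt_of_le_of_lt (ciSup_le fun j => ?_) (half_lt_self hδ)
        have := hM (n + j) (by omega)
        rw [Real.dist_eq, sub_zero] at this
        exact (le_abs_self _).trans this.le
      simpa using h4.const_mul c
  · filter_upwards [hzeq n, hbdd] with ω h1 h2 i
    rw [h1, smul_oneVec_apply]
    exact mul_le_mul_of_nonneg_left (le_ciSup (h2 n) 0) hc

theorem coord_smul_add_smul_nonneg {c e : ℝ} (hc0 : 0 ≤ c) (hc1 : c ≤ 1) (he : 0 < e) {x z : Vec d}
    {i : Fin d} (h : e⁻¹ * ‖x‖ ≤ z i) : 0 ≤ (c • x + e • z) i := by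
  rw [inv_mul_le_iff₀ he] at h
  have h5 := abs_le.1 (show |x i| ≤ ‖x‖ from PiLp.norm_apply_le x i)
  simp only [PiLp.add_apply, PiLp.smul_apply, smul_eq_mul]
  nlinarith [mul_le_mul_of_nonneg_left h5.1 hc0, mul_le_mul_of_nonneg_right hc1 (norm_nonneg x)]

/-- An approximant of `x n` is mixed, with small weight `e`, with a compensated majorant of the
error `x n - a`. The mixture dominates a scaled and shifted copy of `a`, and `A` is stable under
decreasing its elements. -/
theorem compensable_closed [IsProbabilityMeasure P] (hp : 1 ≤ p) (hH : H ≤ mΩ) (hHG : H ≤ G)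
    (hG : G ≤ mΩ) (h0 : (0 : RV P d) ∈ A) (hA : CondConvex P H A) (hAG : A ⊆ L0 P G)
    (hlow : ∀ a ∈ A, ∀ z ∈ L0Sel P G (fun _ => posOrthant d), a - z ∈ A)
    (hcomp : ∀ z : ℕ → RV P d, DecreasesToZero P p G z →
      ∃ γ : ℕ → RV P d, DecreasesToZero P p H γ ∧ ∀ n, z n - γ n ∈ A)
    {x : ℕ → RV P d} {a : RV P d} (hx : ∀ n, x n ∈ compensable P H A ∩ L0 P G)
    (hxa : TendstoLp P p H x a) : a ∈ compensable P H A ∩ L0 P G := by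
  have haG : a ∈ L0 P G := by
    obtain ⟨φ, -, hφ⟩ := (TendstoLp.tendsto0 hp hxa).exists_seq_tendsto_ae
    exact mem_L0_of_ae_tendsto (fun n => (hx (φ n)).2) hφ
  refine ⟨fun ε hε => ?_, haG⟩
  -- Three exceptional events, each of probability at most `e`, must fit into `ε`; `e ≤ 1` makes `1
  -- - e` a convexity weight.
  obtain ⟨e, he, he1, heε⟩ : ∃ e : ℝ, 0 < e ∧ e ≤ 1 ∧ 3 * e ≤ ε :=
    ⟨min (ε / 3) 1, by positivity, min_le_right _ _, by linarith [min_le_left (ε / 3) 1]⟩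
  obtain ⟨φ, -, hφa, B, hB, hPB, g, hg, hdom⟩ := hxa.exists_dominated_subseq hH hp he
  choose f hf hfeq using fun n => exists_measurable_rep (hx (φ n)).2
  obtain ⟨b, hb, hbeq⟩ := exists_measurable_rep haG
  have hBG := hHG _ hB
  -- The factor `e⁻¹` offsets the weight `e` with which `z n` enters the mixture.
  obtain ⟨z, hz, hzle⟩ := decreasesToZero_iSup (d := d) (P := P) (p := p) hG
    (h := fun n => B.indicator fun ω => ‖f n ω - b ω‖)
    (fun n => (measurable_norm.comp ((hf n).sub hb)).indicator hBG)
    (fun n ω => Set.indicator_nonneg (fun _ _ => norm_nonneg _) ω) (by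
      filter_upwards [hφa, ae_all_iff.2 hfeq, hbeq] with ω h1 h2 h3
      simp only [h2, h3] at h1
      by_cases hω : ω ∈ B
      · simpa [hω] using (h1.sub_const (b ω)).norm
      · simp [hω]) hg.norm (fun n => by
      filter_upwards [hdom n, hfeq n, hbeq] with ω h1 h2 h3
      by_cases hω : ω ∈ B
      · rw [Set.indicator_of_mem hω, ← h2, ← h3]
        exact (h1 hω).trans (le_abs_self _)
      · rw [Set.indicator_of_notMem hω]
        exact norm_nonneg _) (c := e⁻¹) (by positivity)
  obtain ⟨γ, hγ, hγA⟩ := hcomp z hz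
  have hγ0 : Tendsto0 P γ 0 := tendsto0_of_ae (by
    filter_upwards [hγ.tendsto, AEEqFun.coeFn_zero (μ := P) (β := Vec d)] with ω h1 h2
    rwa [h2])
  obtain ⟨n, N₁, hN₁, hγn⟩ := (hγ0.eventually_exists he).exists
  obtain ⟨l, hl, hl01, β, hβ, N₂, hN₂, hlβ, u, hu, hueq⟩ := (hx (φ n)).1 e he
  obtain ⟨β', hβ', hβeq⟩ := exists_measurable_rep hβ
  obtain ⟨γ', hγ', hγeq⟩ := exists_measurable_rep (hγ.mem_L0 n)
  let α : Ω → ℝ := B.indicator fun _ => 1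
  have hα : Measurable[H] α := Measurable.indicator measurable_const hB
  have hα01 : ∀ ω, 0 ≤ α ω ∧ α ω ≤ 1 := fun ω => by by_cases h : ω ∈ B <;> simp [α, h]
  have hαB : ∀ ω ∈ B, α ω = 1 := fun ω h => by simp [α, h]
  have he1' : 0 ≤ 1 - e := by linarith
  have hlm : Measurable[H] fun ω => (1 - e) * (α ω * l ω) := (hα.mul hl).const_mul _
  have hcm : Measurable[H] fun ω => ((1 - e) * α ω) • β' ω + e • γ' ω :=
    ((hα.const_mul _).smul hβ').add (hγ'.const_smul e)
  obtain ⟨κ, hκ, hκeq⟩ := exists_mem_L0 P hH hcm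
  have hζm : Measurable[G] fun ω => ((1 - e) * (α ω * l ω)) • b ω -
      (((1 - e) * α ω) • β' ω + e • γ' ω) :=
    ((hlm.mono hHG le_rfl).smul hb).sub (hcm.mono hHG le_rfl)
  obtain ⟨ζ, hζ, hζeq⟩ := exists_mem_L0 P hG hζm
  -- The approximant `u` of `x (φ n)` is first set to zero off `B`, where the error is not
  -- dominated, and then mixed with `z n - γ n`.
  obtain ⟨w, hw, hweq⟩ := hA.exists_mem hH hα hα01 hu h0
  obtain ⟨v, hv, hveq⟩ := hA.exists_mem hH (α := fun _ => 1 - e) measurable_const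
    (fun _ => ⟨he1', by linarith⟩) hw (hγA n)
  refine ⟨fun ω => (1 - e) * (α ω * l ω), hlm, fun ω => ⟨?_, ?_⟩, κ, hκ, N₁ ∪ N₂ ∪ Bᶜ, ?_, ?_,
    ζ, ?_, ?_⟩
  · exact mul_nonneg he1' (mul_nonneg (hα01 ω).1 (hl01 ω).1)
  · exact mul_le_one₀ (by linarith) (mul_nonneg (hα01 ω).1 (hl01 ω).1)
      (mul_le_one₀ (hα01 ω).2 (hl01 ω).1 (hl01 ω).2)
  · calc P (N₁ ∪ N₂ ∪ Bᶜ) ≤ P N₁ + P N₂ + P Bᶜ :=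
        (measure_union_le _ _).trans (add_le_add_left (measure_union_le _ _) _)
      _ ≤ ENNReal.ofReal e + ENNReal.ofReal e + ENNReal.ofReal e :=
        add_le_add (add_le_add hN₁ hN₂) hPB
      _ = ENNReal.ofReal (e + e + e) := by
        rw [ENNReal.ofReal_add (by positivity) he.le, ENNReal.ofReal_add he.le he.le]
      _ ≤ ENNReal.ofReal ε := ENNReal.ofReal_le_ofReal (by linarith)
  · filter_upwards [hlβ, hκeq, hβeq, hγeq, AEEqFun.coeFn_zero (μ := P) (β := Vec d)]
      with ω h1 h2 h3 h4 h5 hω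
    simp only [Set.mem_union, Set.mem_compl_iff, not_or, not_not] at hω
    obtain ⟨h6, h7⟩ := h1 hω.1.2
    have h8 := hγn ω hω.1.1
    rw [h5, Pi.zero_apply, sub_zero] at h8
    rw [h2, ← h3, ← h4, hαB ω hω.2]
    constructor
    · nlinarith [(hl01 ω).1, (hl01 ω).2]
    · refine (norm_add_le _ _).trans ?_
      rw [norm_smul, norm_smul, Real.norm_of_nonneg (by linarith), Real.norm_of_nonneg he.le]
      nlinarith [norm_nonneg (β ω), norm_nonneg (γ n ω)]
  -- The difference `v - ζ` equals `(1 - e) α l (x (φ n) - a) + e z n`, whose coordinates are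
  -- nonnegative because `e z n` majorizes the norm of the error on `B`.
  · have h1 : ζ = v - (v - ζ) := by abel
    rw [h1]
    refine hlow _ hv _ ⟨sub_mem_L0 (hAG hv) hζ, ?_⟩
    filter_upwards [hzle n, AEEqFun.coeFn_sub (v) ζ, hveq, hweq, hζeq, AEEqFun.coeFn_sub (z n) (γ n), hueq, hfeq n, hβeq, hγeq,
      AEEqFun.coeFn_zero (μ := P) (β := Vec d)] with ω e1 e2 e3 e4 e5 e6 e7 e8 e9 e10 e11 i
    have h2 : (v - ζ) ω =
        ((1 - e) * (α ω * l ω)) • (f n ω - b ω) + e • z n ω := by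
      rw [e2, Pi.sub_apply, e3, e4, e5, e6, e7, Pi.sub_apply, e8, e9, e10, e11, Pi.zero_apply]
      module
    rw [h2]
    have h3 := e1 i
    by_cases hω : ω ∈ B
    · rw [Set.indicator_of_mem hω] at h3
      rw [hαB ω hω, one_mul]
      exact coord_smul_add_smul_nonneg (mul_nonneg he1' (hl01 ω).1)
        (mul_le_one₀ (by linarith) (hl01 ω).1 (hl01 ω).2) he h3
    · rw [Set.indicator_of_notMem hω, mul_zero] at h3
      have h4 : α ω = 0 := by simp [α, hω]
      rw [h4, zero_mul, mul_zero, zero_smul, zero_add]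
      exact mul_nonneg he.le h3
  · filter_upwards [hζeq, hκeq, hbeq] with ω h1 h2 h3
    rw [h1, h2, h3]

theorem clp_inter_L0_subset_cl0 [IsProbabilityMeasure P] (hp : 1 ≤ p) (hH : H ≤ mΩ) (hHG : H ≤ G)
    (hG : G ≤ mΩ) (h0 : (0 : RV P d) ∈ A) (hA : CondConvex P H A) (hAG : A ⊆ L0 P G)
    (hlow : ∀ a ∈ A, ∀ z ∈ L0Sel P G (fun _ => posOrthant d), a - z ∈ A)
    (hcomp : ∀ z : ℕ → RV P d, DecreasesToZero P p G z →
      ∃ γ : ℕ → RV P d, DecreasesToZero P p H γ ∧ ∀ n, z n - γ n ∈ A) :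
    clp P p H (A ∩ LpFam P p G) ∩ L0 P H ⊆ cl0 P (A ∩ L0 P H) := by
  rintro ξ ⟨hξ, hξH⟩
  have key : clp P p H (A ∩ LpFam P p G) ⊆ compensable P H A ∩ L0 P G :=
    convClosure_subset (fun a ha => ⟨subset_compensable ha.1, ha.2.1⟩) fun x a hx hxa =>
      compensable_closed hp hH hHG hG h0 hA hAG hlow hcomp hx hxa
  exact mem_cl0_of_mem_compensable (key hξ).1 hξH

end Compensable

/-! ### Measurable random subsequences. -/

section RandomSubsequence

variable {Ω : Type*} {H : MeasurableSpace Ω} {d : ℕ}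

theorem measurable_apply_randomIndex {E : Type*} [MeasurableSpace E] {f : ℕ → Ω → E}
    (hf : ∀ n, Measurable (f n)) {σ : Ω → ℕ} (hσ : Measurable σ) :
    Measurable fun ω => f (σ ω) ω :=
  (measurable_from_prod_countable_right (f := fun q : ℕ × Ω => f q.1 q.2) hf).comp
    (hσ.prodMk measurable_id)

/-- The pointwise limsup is a measurable accumulation point; taking the least later index
sufficiently close to it is a measurable choice. -/
theorem exists_measurable_subseq_real {h : ℕ → Ω → ℝ} (hm : ∀ n, Measurable (h n))
    (hb : ∀ n ω, |h n ω| ≤ 1) :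
    ∃ σ : ℕ → Ω → ℕ, (∀ j, Measurable (σ j)) ∧ (∀ ω, StrictMono fun j => σ j ω) ∧
      ∀ ω, ∃ l, Tendsto (fun j => h (σ j ω) ω) atTop (𝓝 l) := by
  let L : Ω → ℝ := fun ω => limsup (fun n => h n ω) atTop
  have hL : Measurable L := Measurable.limsup hm
  have hfreq : ∀ ω, ∀ ε > 0, ∃ᶠ n in atTop, |h n ω - L ω| < ε := by
    intro ω ε hε
    have hu : IsBoundedUnder (· ≤ ·) atTop fun n => h n ω :=
      isBoundedUnder_of ⟨1, fun n => (abs_le.1 (hb n ω)).2⟩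
    have hl : IsBoundedUnder (· ≥ ·) atTop fun n => h n ω :=
      isBoundedUnder_of ⟨-1, fun n => (abs_le.1 (hb n ω)).1⟩
    have h1 : ∃ᶠ n in atTop, L ω - ε < h n ω :=
      frequently_lt_of_lt_limsup hl.isCoboundedUnder_flip (sub_lt_self _ hε)
    have h2 : ∀ᶠ n in atTop, h n ω < L ω + ε :=
      eventually_lt_of_limsup_lt (lt_add_of_pos_right _ hε) hu
    refine (h1.and_eventually h2).mono fun n hn => ?_
    rw [abs_lt]
    constructor <;> linarith [hn.1, hn.2]
  have step : ∀ (τ : {τ : Ω → ℕ // Measurable τ}) (j : ℕ), ∃ τ' : {τ : Ω → ℕ // Measurable τ},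
      ∀ ω, τ.1 ω < τ'.1 ω ∧ |h (τ'.1 ω) ω - L ω| < 1 / ((j : ℝ) + 1) := by
    classical
    rintro ⟨τ, hτ⟩ j
    have hex : ∀ ω, ∃ n, τ ω < n ∧ |h n ω - L ω| < 1 / ((j : ℝ) + 1) := fun ω =>
      (((hfreq ω _ (by positivity)).and_eventually (eventually_gt_atTop (τ ω))).mono
        fun n hn => ⟨hn.2, hn.1⟩).exists
    refine ⟨⟨fun ω => Nat.find (hex ω), measurable_find hex fun k => ?_⟩,
      fun ω => Nat.find_spec (hex ω)⟩
    change MeasurableSet ({ω | τ ω < k} ∩ {ω | ‖h k ω - L ω‖ < 1 / ((j : ℝ) + 1)})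
    exact (measurableSet_lt hτ measurable_const).inter
      (measurableSet_lt ((hm k).sub hL).norm measurable_const)
  choose next hnext using step
  let σ : ℕ → {τ : Ω → ℕ // Measurable τ} := fun j =>
    Nat.rec ⟨fun _ => 0, measurable_const⟩ (fun j τ => next τ j) j
  have hσ : ∀ j, σ (j + 1) = next (σ j) j := fun _ => rfl
  -- The initial index `0` need not be close to the limsup, hence the shift by one.
  refine ⟨fun j => (σ (j + 1)).1, fun j => (σ (j + 1)).2, fun ω => strictMono_nat_of_lt_succ
    fun j => ?_, fun ω => ⟨L ω, ?_⟩⟩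
  · change (σ (j + 1)).1 ω < (σ (j + 1 + 1)).1 ω
    rw [hσ (j + 1)]
    exact (hnext _ _ ω).1
  · rw [tendsto_iff_norm_sub_tendsto_zero]
    refine squeeze_zero (fun _ => norm_nonneg _) (fun j => ?_)
      tendsto_one_div_add_atTop_nhds_zero_nat
    change ‖h ((σ (j + 1)).1 ω) ω - L ω‖ ≤ _
    rw [hσ j]
    exact (hnext _ _ ω).2.le

/-- Coordinates are treated one at a time; refining the subsequence preserves the limits already
obtained. -/
theorem exists_measurable_subseq {f : ℕ → Ω → Vec d} (hm : ∀ n, Measurable (f n))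
    (hb : ∀ n ω, ‖f n ω‖ ≤ 1) :
    ∃ σ : ℕ → Ω → ℕ, (∀ j, Measurable (σ j)) ∧ (∀ ω, StrictMono fun j => σ j ω) ∧
      ∃ l : Ω → Vec d, Measurable l ∧
        ∀ ω, Tendsto (fun j => f (σ j ω) ω) atTop (𝓝 (l ω)) := by
  have key : ∀ s : Finset (Fin d), ∃ σ : ℕ → Ω → ℕ, (∀ j, Measurable (σ j)) ∧
      (∀ ω, StrictMono fun j => σ j ω) ∧
      ∀ ω, ∀ i ∈ s, ∃ l, Tendsto (fun j => f (σ j ω) ω i) atTop (𝓝 l) := by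
    intro s
    induction s using Finset.induction_on with
    | empty => exact ⟨fun j _ => j, fun j => measurable_const, fun ω => strictMono_id, by simp⟩
    | insert i s _ ih =>
      obtain ⟨σ, hσ, hσm, hσl⟩ := ih
      obtain ⟨τ, hτ, hτm, hτl⟩ := exists_measurable_subseq_real
        (h := fun j ω => f (σ j ω) ω i)
        (fun j => measurable_apply_randomIndex (fun n => measurable_coord (hm n) i) (hσ j))
        (fun j ω => (PiLp.norm_apply_le (f (σ j ω) ω) i).trans (hb _ ω))
      refine ⟨fun j ω => σ (τ j ω) ω, fun j => measurable_apply_randomIndex hσ (hτ j),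
        fun ω => (hσm ω).comp (hτm ω), fun ω k hk => ?_⟩
      rcases Finset.mem_insert.1 hk with rfl | hk
      · exact hτl ω
      · obtain ⟨l, hl⟩ := hσl ω k hk
        exact ⟨l, hl.comp (hτm ω).tendsto_atTop⟩
  obtain ⟨σ, hσ, hσm, hσl⟩ := key Finset.univ
  choose l hl using fun ω i => hσl ω i (Finset.mem_univ i)
  have hlim : ∀ ω, Tendsto (fun j => f (σ j ω) ω) atTop (𝓝 (WithLp.toLp 2 (l ω))) := fun ω =>
    tendsto_vec_iff.2 (hl ω)
  exact ⟨σ, hσ, hσm, _, measurable_of_tendsto_metrizable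
    (fun j => measurable_apply_randomIndex hm (hσ j)) (tendsto_pi_nhds.2 hlim), hlim⟩

end RandomSubsequence

/-! ### A recession argument for sums with selections of a closed convex set. -/

section Closedness

variable {Ω : Type*} {H mΩ : MeasurableSpace Ω} {P : Measure Ω} {d : ℕ} {R : Set (RV P d)}

/-- Conditional convexity pastes the finitely many pieces with index below `N`, with zero elsewhere;
then `N → ∞`. -/
theorem mem_cl0_of_randomIndex [IsFiniteMeasure P] (hH : H ≤ mΩ) (hR : CondConvex P H R)
    (h0 : (0 : RV P d) ∈ R) {r : ℕ → RV P d} (hr : ∀ n, r n ∈ R) {σ : Ω → ℕ}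
    (hσ : Measurable[H] σ) {ζ : RV P d} (hζ : ∀ᵐ ω ∂P, ζ ω = r (σ ω) ω) : ζ ∈ cl0 P R := by
  have key : ∀ N : ℕ, ∃ x ∈ R, ∀ᵐ ω ∂P, x ω = if σ ω < N then r (σ ω) ω else 0 := by
    intro N
    induction N with
    | zero => exact ⟨0, h0, by simpa using! AEEqFun.coeFn_zero (μ := P) (β := Vec d)⟩
    | succ N ih =>
      obtain ⟨x, hx, hxeq⟩ := ih
      obtain ⟨y, hy, hyeq⟩ := hR.exists_mem hH (α := {ω | σ ω = N}.indicator fun _ => 1)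
        (Measurable.indicator measurable_const (hσ (measurableSet_singleton N)))
        (fun ω => by by_cases h : σ ω = N <;> simp [h]) (hr N) hx
      refine ⟨y, hy, ?_⟩
      filter_upwards [hxeq, hyeq] with ω h1 h2
      rw [h2, h1]
      rcases lt_trichotomy (σ ω) N with h | h | h
      · simp [h.ne, h, h.trans N.lt_succ_self]
      · simp [h]
      · simp [h.ne', not_lt.2 h.le, not_lt.2 (Nat.succ_le_of_lt h)]
  choose x hx hxeq using key
  refine mem_cl0_of_ae_tendsto (fun n => subset_convClosure (hx n)) ?_
  filter_upwards [ae_all_iff.2 hxeq, hζ] with ω h1 h2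
  refine tendsto_const_nhds.congr' ?_
  filter_upwards [eventually_gt_atTop (σ ω)] with n hn
  rw [h1, if_pos hn, h2]

/-- If `k n + r n → ξ`, either `k n` has a convergent random subsequence, and then `ξ` splits as an
element of `L0Sel P H K + cl0 P R`, or `k n` escapes to infinity in some unit direction `h ∈ K`. In
the latter case the rescaled `r n` tend to `-h`, a nonzero selection of `-K` in `cl0 P R`, which the
hypothesis excludes. -/
theorem cl0_add_inter_subset [IsFiniteMeasure P] (hH : H ≤ mΩ) {K : Ω → Set (Vec d)}
    (hK : ∀ᵐ ω ∂P, IsClosed (K ω)) (hKc : ∀ᵐ ω ∂P, Convex ℝ (K ω))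
    (hK0 : ∀ᵐ ω ∂P, (0 : Vec d) ∈ K ω) (hR : CondConvex P H R) (h0 : (0 : RV P d) ∈ R)
    (hRH : R ⊆ L0 P H)
    (hRK : (L0Sel P H K + cl0 P R) ∩ L0Sel P H (fun ω => -(K ω)) ⊆ {0}) :
    cl0 P (L0Sel P H K + R) ∩ L0Sel P H (fun ω => -(K ω)) ⊆ {0} := by
  rintro ξ ⟨hξ, hξK⟩
  obtain ⟨y, hy, hyξ⟩ := exists_ae_tendsto_of_mem_cl0 hξ
  choose k hk r hr hkr using hy
  simp only at hkr
  choose k' hk'm hk'eq using fun n => exists_measurable_rep (hk n).1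
  choose r' hr'm hr'eq using fun n => exists_measurable_rep (hRH (hr n))
  have hpos : ∀ v : Vec d, 0 < 1 + ‖v‖ := fun v => by positivity
  -- This map compresses the space homeomorphically onto the open unit ball, so escape to infinity
  -- becomes `‖h‖ = 1`.
  let N : Vec d → Vec d := fun v => (1 + ‖v‖)⁻¹ • v
  have hNm : Measurable N := (measurable_norm.const_add 1).inv.smul measurable_id
  have hN : ∀ v, 1 - ‖N v‖ = (1 + ‖v‖)⁻¹ := fun v => by
    have := hpos v
    simp only [N]
    rw [norm_smul, norm_inv, Real.norm_of_nonneg this.le]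
    field_simp
    ring
  have hN1 : ∀ v, ‖N v‖ ≤ 1 := fun v => by
    have := inv_pos.2 (hpos v)
    linarith [hN v]
  have hinv1 : ∀ v : Vec d, (1 + ‖v‖)⁻¹ ≤ 1 := fun v => by linarith [hN v, norm_nonneg (N v)]
  obtain ⟨σ, hσ, hσm, h, hhm, hh⟩ := exists_measurable_subseq (f := fun n ω => N (k' n ω))
    (fun n => hNm.comp (hk'm n)) (fun n ω => hN1 _)
  have hkm : ∀ j, Measurable[H] fun ω => k' (σ j ω) ω := fun j =>
    measurable_apply_randomIndex hk'm (hσ j)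
  have hrm : ∀ j, Measurable[H] fun ω => r' (σ j ω) ω := fun j =>
    measurable_apply_randomIndex hr'm (hσ j)
  have hkK : ∀ᵐ ω ∂P, ∀ n, k' n ω ∈ K ω := ae_all_iff.2 fun n => by
    filter_upwards [(hk n).2, hk'eq n] with ω h1 h2
    rwa [← h2]
  have hsum : ∀ᵐ ω ∂P, Tendsto (fun j => k' (σ j ω) ω + r' (σ j ω) ω) atTop (𝓝 (ξ ω)) := by
    filter_upwards [hyξ, ae_all_iff.2 hk'eq, ae_all_iff.2 hr'eq,
      ae_all_iff.2 fun n => AEEqFun.coeFn_add (k n) (r n)] with ω h1 h2 h3 h4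
    refine (h1.comp (hσm ω).tendsto_atTop).congr fun j => ?_
    simp only [Function.comp]
    rw [← hkr, h4, Pi.add_apply, h2, h3]
  choose ρ hρ hρeq using fun j => exists_mem_L0 P hH (hrm j)
  have hρR : ∀ j, ρ j ∈ cl0 P R := fun j => by
    refine mem_cl0_of_randomIndex hH hR h0 hr (hσ j) ?_
    filter_upwards [hρeq j, ae_all_iff.2 hr'eq] with ω h1 h2
    rw [h1, h2]
  have hcl0 : (0 : RV P d) ∈ cl0 P R := subset_convClosure h0
  have hinv : ∀ ω, Tendsto (fun j => (1 + ‖k' (σ j ω) ω‖)⁻¹) atTop (𝓝 (1 - ‖h ω‖)) := fun ω => by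
    simpa only [hN] using (hh ω).norm.const_sub 1
  have hzero : (0 : RV P d) ∈ L0Sel P H K := zero_mem_L0Sel hK0
  have hne : ∀ᵐ ω ∂P, ‖h ω‖ ≠ 1 := by
    let B : Set Ω := {ω | ‖h ω‖ = 1}
    have hB : MeasurableSet[H] B := (measurable_norm.comp hhm) (measurableSet_singleton 1)
    obtain ⟨ζ, hζ, hζeq⟩ := exists_mem_L0 P hH (hhm.neg.indicator hB)
    have hα : ∀ j, Measurable[H] (B.indicator fun ω => (1 + ‖k' (σ j ω) ω‖)⁻¹) := fun j =>
      Measurable.indicator ((measurable_norm.comp (hkm j)).const_add 1).inv hB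
    have hα01 : ∀ j ω, 0 ≤ B.indicator (fun ω => (1 + ‖k' (σ j ω) ω‖)⁻¹) ω ∧
        B.indicator (fun ω => (1 + ‖k' (σ j ω) ω‖)⁻¹) ω ≤ 1 := fun j ω => by
      by_cases hω : ω ∈ B
      · rw [Set.indicator_of_mem hω]
        exact ⟨(inv_pos.2 (hpos _)).le, hinv1 _⟩
      · simp [hω]
    choose x hx hxeq using fun j => (hR.cl0 hH).exists_mem hH (hα j) (hα01 j) (hρR j) hcl0
    have hζR : ζ ∈ cl0 P R := by
      refine mem_cl0_of_ae_tendsto hx ?_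
      filter_upwards [hsum, hζeq, ae_all_iff.2 hxeq, ae_all_iff.2 hρeq,
        AEEqFun.coeFn_zero (μ := P) (β := Vec d)] with ω h1 h2 h3 h4 h5
      simp only [h2, h3, h4, h5]
      by_cases hω : ω ∈ B
      -- The rescaled `r` is the rescaled sum minus `N k`; the sum converges and its factor
      -- vanishes, so `-h` remains.
      · have h6 := ((hinv ω).smul h1).sub (hh ω)
        rw [show ‖h ω‖ = 1 from hω, sub_self, zero_smul, zero_sub] at h6
        simp only [Set.indicator_of_mem hω, Pi.zero_apply, smul_zero, add_zero, Pi.neg_apply]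
        refine h6.congr fun j => ?_
        simp only [N]
        module
      · simp [hω]
    have hζK : ζ ∈ L0Sel P H (fun ω => -(K ω)) := by
      refine ⟨hζ, ?_⟩
      filter_upwards [hζeq, hK, hKc, hK0, hkK] with ω h1 h2 h3 h4 h5
      rw [h1, Set.mem_neg]
      by_cases hω : ω ∈ B
      · rw [Set.indicator_of_mem hω, Pi.neg_apply, neg_neg]
        refine h2.mem_of_tendsto (hh ω) (Eventually.of_forall fun j => ?_)
        exact h3.smul_mem_of_zero_mem h4 (h5 _) ⟨(inv_pos.2 (hpos _)).le, hinv1 _⟩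
      · simpa [hω] using h4
    have hζ0 : ζ = 0 := hRK ⟨⟨0, hzero, ζ, hζR, zero_add ζ⟩, hζK⟩
    rw [hζ0] at hζeq
    filter_upwards [hζeq, AEEqFun.coeFn_zero (μ := P) (β := Vec d)] with ω h1 h2 hω
    rw [h2, Set.indicator_of_mem (show ω ∈ B from hω), Pi.zero_apply, Pi.neg_apply, eq_comm,
      neg_eq_zero] at h1
    rw [h1, norm_zero] at hω
    exact zero_ne_one hω
  have hqm : Measurable[H] fun ω => (1 - ‖h ω‖)⁻¹ • h ω :=
    ((measurable_norm.comp hhm).const_sub 1).inv.smul hhm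
  obtain ⟨κ, hκ, hκeq⟩ := exists_mem_L0 P hH hqm
  have hlim : ∀ᵐ ω ∂P, Tendsto (fun j => k' (σ j ω) ω) atTop (𝓝 (κ ω)) := by
    filter_upwards [hne, hκeq] with ω h1 h2
    rw [h2]
    refine (((hinv ω).inv₀ (sub_ne_zero.2 (Ne.symm h1))).smul (hh ω)).congr fun j => ?_
    simp only [N]
    rw [inv_inv, smul_inv_smul₀ (hpos _).ne']
  refine hRK ⟨⟨κ, ⟨hκ, ?_⟩, ξ - κ, mem_cl0_of_ae_tendsto hρR ?_, add_sub_cancel _ _⟩, hξK⟩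
  · filter_upwards [hlim, hK, hkK] with ω h1 h2 h3
    exact h2.mem_of_tendsto h1 (Eventually.of_forall fun j => h3 _)
  · filter_upwards [hlim, hsum, ae_all_iff.2 hρeq, AEEqFun.coeFn_sub ξ κ] with ω h1 h2 h3 h4
    simp only [h3, h4, Pi.sub_apply]
    simpa using h2.sub h1

end Closedness

/-! ### The equivalences between closures and the two arbitrage conditions. -/

section Equivalence

variable {Ω : Type*} {H G mΩ : MeasurableSpace Ω} {P : Measure Ω} {d : ℕ} {p : ℝ≥0∞}

theorem cl0_neg [IsFiniteMeasure P] (S : Set (RV P d)) : cl0 P (-S) = -cl0 P S := by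
  have key : ∀ S : Set (RV P d), cl0 P (-S) ⊆ -cl0 P S := by
    intro S ξ hξ
    obtain ⟨y, hy, h⟩ := exists_ae_tendsto_of_mem_cl0 hξ
    refine mem_cl0_of_ae_tendsto (y := fun n => -y n) (fun n => subset_convClosure (hy n)) ?_
    filter_upwards [h, AEEqFun.coeFn_neg ξ, ae_all_iff.2 fun n => AEEqFun.coeFn_neg (y n)]
      with ω h1 h2 h3
    simp only [h2, h3]
    exact h1.neg
  refine (key S).antisymm ?_
  have h := Set.neg_subset_neg.2 (key (-S))
  rwa [neg_neg, neg_neg] at h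

theorem neg_inter_L0Sel_eq_iff {S : Set (RV P d)} {X : Ω → Set (Vec d)} :
    -S ∩ L0Sel P H (fun ω => -(X ω)) = {0} ↔ S ∩ L0Sel P H X = {0} := by
  have h : -S ∩ L0Sel P H (fun ω => -(X ω)) = -(S ∩ L0Sel P H X) := by
    ext ξ
    have := neg_mem_L0Sel_neg_iff (P := P) (H := H) (X := X) (ξ := -ξ)
    rw [neg_neg] at this
    exact and_congr Iff.rfl this
  rw [h, neg_eq_iff_eq_neg]
  simp

theorem cl0_L0Sel {X : Ω → Set (Vec d)} (hX : ∀ᵐ ω ∂P, IsClosed (X ω)) :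
    cl0 P (L0Sel P H X) = L0Sel P H X := by
  refine Set.Subset.antisymm (fun ξ hξ => ?_) subset_convClosure
  obtain ⟨y, hy, h⟩ := exists_ae_tendsto_of_mem_cl0 hξ
  refine ⟨mem_L0_of_ae_tendsto (fun n => (hy n).1) h, ?_⟩
  filter_upwards [h, hX, ae_all_iff.2 fun n => (hy n).2] with ω h1 h2 h3
  exact h2.mem_of_tendsto h1 (Eventually.of_forall h3)

theorem L0Sel_eq_zero {X : Ω → Set (Vec d)} (hX : ∀ᵐ ω ∂P, X ω = {0}) : L0Sel P H X = {0} := by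
  refine Set.Subset.antisymm (fun ξ hξ => ?_) (Set.singleton_subset_iff.2 (zero_mem_L0Sel ?_))
  · refine AEEqFun.ext ?_
    filter_upwards [hξ.2, hX, AEEqFun.coeFn_zero (μ := P) (β := Vec d)] with ω h1 h2 h3
    rw [h3]
    rw [h2] at h1
    exact h1
  · filter_upwards [hX] with ω h
    rw [h]
    rfl

theorem L0Sel_inter (X Y : Ω → Set (Vec d)) :
    L0Sel P H X ∩ L0Sel P H Y = L0Sel P H (fun ω => X ω ∩ Y ω) := by
  ext ξ
  constructor
  · rintro ⟨h1, h2⟩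
    exact ⟨h1.1, h1.2.and h2.2⟩
  · rintro ⟨h1, h2⟩
    exact ⟨⟨h1, h2.mono fun _ h => h.1⟩, ⟨h1, h2.mono fun _ h => h.2⟩⟩

/-- The forward direction localizes, `0 ∈ X` ensuring that a truncated selection remains a
selection; the converse is the inclusion `clp_inter_L0_subset_cl0`. -/
theorem clp_inter_L0Sel_eq_iff [IsProbabilityMeasure P] (hp : 1 ≤ p) (hH : H ≤ mΩ) (hHG : H ≤ G)
    (hG : G ≤ mΩ) {A : Set (RV P d)} (h0 : (0 : RV P d) ∈ A) (hA : CondConvex P H A)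
    (hAG : A ⊆ L0 P G) (hlow : ∀ a ∈ A, ∀ z ∈ L0Sel P G (fun _ => posOrthant d), a - z ∈ A)
    (hcomp : ∀ z : ℕ → RV P d, DecreasesToZero P p G z →
      ∃ γ : ℕ → RV P d, DecreasesToZero P p H γ ∧ ∀ n, z n - γ n ∈ A)
    {X : Ω → Set (Vec d)} (hX : ∀ᵐ ω ∂P, (0 : Vec d) ∈ X ω) :
    clp P p H (A ∩ LpFam P p G) ∩ L0Sel P H X = {0} ↔
      cl0 P (A ∩ L0 P H) ∩ L0Sel P H X = {0} := by
  have hX0 : (0 : RV P d) ∈ L0Sel P H X := zero_mem_L0Sel hX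
  constructor
  · intro h
    refine Set.Subset.antisymm ?_
      (Set.singleton_subset_iff.2 ⟨subset_convClosure ⟨h0, zero_mem_L0⟩, hX0⟩)
    rintro ξ ⟨hξ, hξX⟩
    obtain ⟨B, hB, hBex, hBmem⟩ := exists_localization_of_mem_cl0 hp hH hHG h0 hA hξ
    obtain ⟨f, hf, hfeq⟩ := exists_measurable_rep hξX.1
    have hz : ∀ᵐ ω ∂P, ∀ k, (B k).indicator f ω = 0 := by
      refine ae_all_iff.2 fun k => ?_
      obtain ⟨ζ, hζ, hζeq⟩ := exists_mem_L0 P hH (hf.indicator (hB k))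
      have h1 : ζ ∈ clp P p H (A ∩ LpFam P p G) := hBmem k ζ (by
        filter_upwards [hζeq, hfeq] with ω e1 e2
        rw [e1]
        by_cases hω : ω ∈ B k <;> simp [hω, e2])
      have h2 : ζ ∈ L0Sel P H X := by
        refine ⟨hζ, ?_⟩
        filter_upwards [hζeq, hfeq, hξX.2, hX] with ω e1 e2 e3 e4
        rw [e1]
        by_cases hω : ω ∈ B k
        · rwa [Set.indicator_of_mem hω, ← e2]
        · rwa [Set.indicator_of_notMem hω]
      have h3 : ζ = 0 := h.subset ⟨h1, h2⟩
      rw [h3] at hζeq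
      filter_upwards [hζeq, AEEqFun.coeFn_zero (μ := P) (β := Vec d)] with ω e1 e2
      rw [← e1, e2]
      rfl
    refine AEEqFun.ext ?_
    filter_upwards [hz, hBex, hfeq, AEEqFun.coeFn_zero (μ := P) (β := Vec d)] with ω e1 e2 e3 e4
    obtain ⟨k, hk⟩ := e2
    rw [e3, e4, ← Set.indicator_of_mem hk f, e1]
    rfl
  · intro h
    refine Set.Subset.antisymm ?_ (Set.singleton_subset_iff.2 ⟨subset_convClosure ⟨h0, zero_mem_L0,
      (memLp_congr_ae AEEqFun.coeFn_zero).2 MemLp.zero⟩, hX0⟩)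
    rintro ξ ⟨hξ, hξX⟩
    exact h.subset
      ⟨clp_inter_L0_subset_cl0 hp hH hHG hG h0 hA hAG hlow hcomp ⟨hξ, hξX.1⟩, hξX⟩

variable {ℱ : Filtration ℕ mΩ} {T : ℕ} {C : ℕ → ℕ → Set (RV P d)} {K : ℕ → Ω → Set (Vec d)}

theorem attainable_subset_L0 (hC : IsAcceptanceFamily P ℱ T p C) {t : ℕ} (ht : t ≤ T) :
    attainable P ℱ C K t T ⊆ L0 P (ℱ T) := by
  induction ht using Nat.decreasingInduction with
  | self => rw [attainable_self]; exact fun ξ hξ => hξ.1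
  | of_succ t ht ih =>
    intro x hx
    obtain ⟨k, hk, c, hc, a, ha, rfl⟩ := (mem_attainable_of_lt ht).1 hx
    exact sub_mem_L0 (sub_mem_L0 (ih ha) (L0_mono (ℱ.mono ht.le) hk.1))
      (L0_mono (ℱ.mono ht) (hC.subset_L0 t.le_succ ht hc))

/-- The closure of the attainable positions and the closure in probability of the endowments meet
opposite families of selections trivially at the same time. -/
theorem attainableClosure_inter_eq_iff [IsProbabilityMeasure P] (hp : 1 ≤ p)
    (hC : IsAcceptanceFamily P ℱ T p C) (hcont : ContinuousFromBelow P ℱ T p C)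
    (hK : IsSolvencyFamily P ℱ T K) {t : ℕ} (ht : t ≤ T) {X : Ω → Set (Vec d)}
    (hX : ∀ᵐ ω ∂P, (0 : Vec d) ∈ X ω) :
    attainableClosure P ℱ T p C K t ∩ L0Sel P (ℱ t) X = {0} ↔
      cl0 P (endow P ℱ T C K t) ∩ L0Sel P (ℱ t) (fun ω => -(X ω)) = {0} := by
  have h : endow P ℱ T C K t = -(attainable P ℱ C K t T ∩ L0 P (ℱ t)) := by
    ext ξ
    exact mem_endow_iff hC ht
  rw [h, cl0_neg, neg_inter_L0Sel_eq_iff]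
  exact clp_inter_L0Sel_eq_iff hp (ℱ.le t) (ℱ.mono ht) (ℱ.le T) (zero_mem_attainable hC hK ht)
    (condConvex_attainable hC hK ht) (attainable_subset_L0 hC ht)
    (fun a ha z hz => sub_mem_attainable hK ht ha hz)
    (fun z hz => exists_attainable_compensator hp hC hcont hK ht hz) hX

theorem condConvex_selRisk0 (hC : IsAcceptanceFamily P ℱ T p C) {t s : ℕ} (hts : t ≤ s)
    (hsT : s ≤ T) {Ξ : Set (RV P d)} (hΞ : CondConvex P (ℱ t) Ξ) :
    CondConvex P (ℱ t) (selRisk0 P ℱ C t s Ξ) := by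
  rintro α hα h01 γ ⟨hγ, ξ, hξ, hγξ⟩ γ' ⟨hγ', ξ', hξ', hγξ'⟩ ζ hζ
  obtain ⟨η, hη, hηeq⟩ := hΞ.exists_mem (ℱ.le t) hα h01 hξ hξ'
  refine ⟨condConvex_L0 P le_rfl α hα h01 γ hγ γ' hγ' ζ hζ, η, hη, ?_⟩
  refine hC.cond_convex t s hts hsT α hα h01 _ hγξ _ hγξ' _ ?_
  filter_upwards [hζ, hηeq, AEEqFun.coeFn_sub ζ η, AEEqFun.coeFn_sub γ ξ,
    AEEqFun.coeFn_sub γ' ξ'] with ω e1 e2 e3 e4 e5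
  rw [e3, e4, e5, Pi.sub_apply, Pi.sub_apply, Pi.sub_apply, e1, e2]
  module

theorem condConvex_endow (hC : IsAcceptanceFamily P ℱ T p C) (hK : IsSolvencyFamily P ℱ T K)
    {t : ℕ} (ht : t ≤ T) : CondConvex P (ℱ t) (endow P ℱ T C K t) := by
  have h : endow P ℱ T C K t = -(attainable P ℱ C K t T ∩ L0 P (ℱ t)) := by
    ext ξ
    exact mem_endow_iff hC ht
  rw [h]
  exact ((condConvex_attainable hC hK ht).inter (condConvex_L0 P le_rfl)).neg

theorem zero_mem_endow (hC : IsAcceptanceFamily P ℱ T p C) (hK : IsSolvencyFamily P ℱ T K)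
    {t : ℕ} (ht : t ≤ T) : (0 : RV P d) ∈ endow P ℱ T C K t := by
  rw [mem_endow_iff hC ht, neg_zero]
  exact ⟨zero_mem_attainable hC hK ht, zero_mem_L0⟩

theorem cl0_endow_self (hK : IsSolvencyFamily P ℱ T K) :
    cl0 P (endow P ℱ T C K T) = L0Sel P (ℱ T) (K T) := by
  rw [endow_self, cl0_L0Sel (hK.closed T le_rfl)]

theorem endowHat_self : endowHat P ℱ T C K T = L0Sel P (ℱ T) (K T) := by
  rw [endowHat, if_neg (lt_irrefl _)]

theorem endowHat_of_lt {t : ℕ} (ht : t < T) : endowHat P ℱ T C K t =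
    L0Sel P (ℱ t) (K t) + cl0 P (selRisk0 P ℱ C t (t + 1) (endow P ℱ T C K (t + 1))) := by
  rw [endowHat, if_pos ht]
  rfl

theorem endowHat_subset_cl0_endow [IsFiniteMeasure P] (hK : IsSolvencyFamily P ℱ T K) {t : ℕ}
    (ht : t ≤ T) : endowHat P ℱ T C K t ⊆ cl0 P (endow P ℱ T C K t) := by
  rcases ht.eq_or_lt with rfl | ht
  · rw [endowHat_self, cl0_endow_self hK]
  rw [endowHat_of_lt ht, endow_of_lt ht]
  rintro _ ⟨k, hk, r, hr, rfl⟩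
  obtain ⟨y, hy, h⟩ := exists_ae_tendsto_of_mem_cl0 hr
  refine mem_cl0_of_ae_tendsto (y := fun n => k + y n)
    (fun n => subset_convClosure (Set.add_mem_add hk (hy n))) ?_
  filter_upwards [h, AEEqFun.coeFn_add k r, ae_all_iff.2 fun n => AEEqFun.coeFn_add k (y n)]
    with ω h1 h2 h3
  simp only [h2, h3, Pi.add_apply]
  exact h1.const_add _

/-- The inclusion of `endowHat` in the full closure gives one direction. The other is the recession
argument before `T`; at `T` both sets are the selections of `K T`. -/
theorem endowHat_inter_subset_iff [IsFiniteMeasure P] (hC : IsAcceptanceFamily P ℱ T p C)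
    (hK : IsSolvencyFamily P ℱ T K) {t : ℕ} (ht : t ≤ T) :
    endowHat P ℱ T C K t ∩ L0Sel P (ℱ t) (fun ω => -(K t ω)) ⊆ {0} ↔
      cl0 P (endow P ℱ T C K t) ∩ L0Sel P (ℱ t) (fun ω => -(K t ω)) = {0} := by
  have hK0 : ∀ᵐ ω ∂P, (0 : Vec d) ∈ -(K t ω) := by
    filter_upwards [hK.zero_mem ht] with ω hω
    simpa using hω
  constructor
  · intro h
    refine Set.Subset.antisymm ?_ (Set.singleton_subset_iff.2
      ⟨subset_convClosure (zero_mem_endow hC hK ht), zero_mem_L0Sel hK0⟩)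
    rcases ht.eq_or_lt with rfl | ht'
    · rwa [cl0_endow_self hK, ← endowHat_self (C := C)]
    · rw [endowHat_of_lt ht'] at h
      rw [endow_of_lt ht']
      exact cl0_add_inter_subset (ℱ.le t) (hK.closed t ht) (hK.convex t ht) (hK.zero_mem ht)
        (condConvex_selRisk0 hC t.le_succ ht'
          ((condConvex_endow hC hK ht').mono (ℱ.mono t.le_succ)))
        ⟨zero_mem_L0, 0, zero_mem_endow hC hK ht', by simpa using hC.zero_mem t.le_succ ht'⟩
        (fun γ hγ => hγ.1) h
  · exact fun h => (Set.inter_subset_inter_left _ (endowHat_subset_cl0_endow hK ht)).trans h.subset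

end Equivalence

end RiskArbitrage

/-! ### The theorem. -/

open RiskArbitrage

theorem mainTheorem2 {Ω : Type*} {mΩ : MeasurableSpace Ω} (P : Measure Ω)
    [IsProbabilityMeasure P] [P.IsComplete]
    (ℱ : Filtration ℕ mΩ) (hℱ : ∀ A : Set Ω, MeasurableSet[ℱ 0] A → P A = 0 ∨ P A = 1)
    (T d : ℕ) (p : ℝ≥0∞) (hp : 1 ≤ p)
    (C : ℕ → ℕ → Set (RV P d)) (hC : IsAcceptanceFamily P ℱ T p C)
    (hcont : ContinuousFromBelow P ℱ T p C)
    (K : ℕ → Ω → Set (Vec d)) (hK : IsSolvencyFamily P ℱ T K) :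
    (NARA P ℱ T C K ↔
      ∀ t, t < T →
        attainableClosure P ℱ T p C K t ∩ L0Sel P (ℱ t) (fun _ => posOrthant d) = {0}) ∧
    (IsProper P T K →
      (SNR P ℱ T C K ↔
        ∀ t, t ≤ T →
          attainableClosure P ℱ T p C K t ∩ L0Sel P (ℱ t) (K t) = {0})) := by
  have hneg : negOrthant d = -posOrthant d := by
    ext x
    simp [negOrthant, posOrthant]
  constructor
  · have h : ∀ t ≤ T,
        (attainableClosure P ℱ T p C K t ∩ L0Sel P (ℱ t) (fun _ => posOrthant d) = {0} ↔
          cl0 P (endow P ℱ T C K t) ∩ L0Sel P (ℱ t) (fun _ => negOrthant d) = {0}) := by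
      intro t ht
      rw [hneg]
      exact attainableClosure_inter_eq_iff hp hC hcont hK ht (by simp [posOrthant])
    refine ⟨fun hN t ht => (h t ht.le).2 (hN t ht.le), fun hA t ht => ?_⟩
    -- (NARA) also covers `t = T`, where it holds automatically because `K T` meets the nonpositive
    -- orthant only at the origin.
    rcases ht.eq_or_lt with rfl | ht'
    · rw [cl0_endow_self hK, L0Sel_inter]
      exact L0Sel_eq_zero (hK.inter_nonpos t le_rfl)
    · exact (h t ht).1 (hA t ht')
  · intro hprop
    refine forall₂_congr fun t ht => ?_
    rw [L0Sel_eq_zero (hprop t ht), endowHat_inter_subset_iff hC hK ht,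
      attainableClosure_inter_eq_iff hp hC hcont hK ht (hK.zero_mem ht)]
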